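/- Let $\sigma>0$ and let $\beta=(\beta_n)_{n\ge 0}$ be the sequence of positive weights determined by $\beta_0=1$, $\beta_1^2=1/\sigma$, $\beta_{m+1}^2=\beta_m^2\,\frac{m+1}{m+\sigma}$ for $m\ge 1$. Let $\mathcal H_\beta$ be the Hilbert space of power series $f=\sum_{n\ge0} a_nz^n$ with $\|f\|_\beta^2=\sum_n|a_n|^2\beta_n^2<\infty$, with inner product $\langle f,g\rangle_\beta=\sum_n a_n\overline{c_n}\beta_n^2$ for $g=\sum_n c_nz^n$; its elements are analytic on the unit disk. For $k\ge 0$ let $\mathcal H_\beta^k$ be the Hilbert space of power series $f=\sum_n a_nz^n$ with $\|f\|_k^2=\sum_n(1+n^{2k})|a_n|^2\beta_n^2<\infty$. Let $N\ge1$ and $L=\sum_{k=0}^N p_k(z)D^k$, $D=d/dz$, where the functions $p_k$ are analytic on (a neighbourhood of) the closed unit disk and $p_N(z)\ne0$ for $|z|=1$ (that is, $L$ is $\mathbb D$-regular of order $N$). Let $\mathcal L_{max}f=Lf$ with domain $\{f\in\mathcal H_\beta : Lf\in\mathcal H_\beta\}$, and let $\mathcal L_{min}$ be the restriction of $\mathcal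 L_{max}$ to the polynomials (all of which lie in the domain of $\mathcal L_{max}$). Suppose that $L$ is formally symmetric on $\mathcal H_\beta$, that is, $\langle Lf,g\rangle_\beta=\langle f,Lg\rangle_\beta$ for all polynomials $f,g$. Then $\mathcal L_{min}$ is closable, $\mathcal L_{max}$ is the closure of $\mathcal L_{min}$, and $\mathcal L_{max}$ is densely defined and self-adjoint. For every $\lambda$ in the resolvent set of $\mathcal L_{max}$, the resolvent $R(\lambda)=(\mathcal L_{max}-\lambda I)^{-1}$ maps $\mathcal H_\beta$ into $\mathcal H_\beta^N$ and is bounded as an operator $\mathcal H_\beta\to\mathcal H_\beta^N$; the norms $\|R(\lambda)\|_{\mathcal H_\beta\to\mathcal H_\beta^N}$ are bounded uniformly for $\lambda$ in any compact subset of the resolvent set; and $R(\lambda):\mathcal H_\beta\to\mathcal H_\beta$ is a compact operator. -/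

import Mathlib

open scoped PowerSeries ComplexConjugate

noncomputable section

/-- A sequence `β 0, β 1, β 2, …` of positive real weights. -/
structure WeightSeq where
  /-- the weights -/
  toFun : ℕ → ℝ
  pos' : ∀ n, 0 < toFun n

namespace WeightSeq

instance : CoeFun WeightSeq (fun _ => ℕ → ℝ) := ⟨WeightSeq.toFun⟩

lemma pos (β : WeightSeq) (n : ℕ) : 0 < β n := β.pos' n

/-- The weights `β n * √(1 + n ^ (2k))`; the weighted Hardy space with these weights is the
Sobolev-type space `H_β^k`, with squared norm `∑ (1 + n ^ (2k)) |c n| ^ 2 (β n) ^ 2`. -/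
def sobolev (β : WeightSeq) (k : ℕ) : WeightSeq where
  toFun n := Real.sqrt (1 + (n : ℝ) ^ (2 * k)) * β n
  pos' n := mul_pos (Real.sqrt_pos.2 (by positivity)) (β.pos n)

end WeightSeq

/-- The weighted Hardy space `H_β`: the power series `∑ a n z ^ n` with
`∑ |a n| ^ 2 (β n) ^ 2 < ∞`. -/
def WeightedHardy (β : WeightSeq) : Submodule ℂ ℂ⟦X⟧ where
  carrier := {f | Summable fun n => ‖PowerSeries.coeff n f‖ ^ 2 * β n ^ 2}
  zero_mem' := by simp
  add_mem' := by
    intro f g hf hg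
    refine Summable.of_nonneg_of_le (fun n => by positivity) (fun n => ?_)
      ((hf.add hg).mul_left 2)
    have h := norm_add_le (PowerSeries.coeff n f) (PowerSeries.coeff n g)
    have h2 : ‖PowerSeries.coeff n (f + g)‖ ^ 2 ≤
        2 * (‖PowerSeries.coeff n f‖ ^ 2 + ‖PowerSeries.coeff n g‖ ^ 2) := by
      rw [map_add]
      nlinarith [sq_nonneg (‖PowerSeries.coeff n f‖ - ‖PowerSeries.coeff n g‖),
        norm_nonneg (PowerSeries.coeff n f + PowerSeries.coeff n g)]
    nlinarith [mul_le_mul_of_nonneg_right h2 (sq_nonneg (β n))]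
  smul_mem' := by
    intro c f hf
    refine (Summable.mul_left (‖c‖ ^ 2) hf).congr (fun n => ?_)
    rw [PowerSeries.coeff_smul, smul_eq_mul, norm_mul]
    ring

namespace WeightedHardy

variable {β : WeightSeq}

/-- The inner product `⟨f, g⟩ = ∑ (f n) (conj (g n)) (β n) ^ 2` is linear in `f`; following
Mathlib's convention it is written `ip g f`, conjugate-linear in the first argument. -/
def ip (g f : WeightedHardy β) : ℂ :=
  ∑' n, conj (PowerSeries.coeff n g.1) * PowerSeries.coeff n f.1 * (β n : ℂ) ^ 2

lemma summable_inner (g f : WeightedHardy β) : Summable fun n =>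
    conj (PowerSeries.coeff n g.1) * PowerSeries.coeff n f.1 * (β n : ℂ) ^ 2 := by
  have hf : Summable fun n => ‖PowerSeries.coeff n f.1‖ ^ 2 * β n ^ 2 := f.2
  have hg : Summable fun n => ‖PowerSeries.coeff n g.1‖ ^ 2 * β n ^ 2 := g.2
  refine Summable.of_norm_bounded (hf.add hg) (fun n => ?_)
  have hb : ‖(β n : ℂ) ^ 2‖ = β n ^ 2 := by
    rw [norm_pow, Complex.norm_real, Real.norm_eq_abs, sq_abs]
  rw [norm_mul, norm_mul, hb, RCLike.norm_conj, ← add_mul]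
  refine mul_le_mul_of_nonneg_right ?_ (sq_nonneg _)
  nlinarith [sq_nonneg (‖PowerSeries.coeff n f.1‖ - ‖PowerSeries.coeff n g.1‖),
    sq_nonneg (‖PowerSeries.coeff n f.1‖ + ‖PowerSeries.coeff n g.1‖)]

lemma ip_self_eq (f : WeightedHardy β) : ip f f =
    ((∑' n, ‖PowerSeries.coeff n f.1‖ ^ 2 * β n ^ 2 : ℝ) : ℂ) := by
  rw [ip, Complex.ofReal_tsum]
  refine tsum_congr (fun n => ?_)
  rw [RCLike.conj_mul]
  push_cast
  rfl

/-- The inner product of `H_β` is a positive definite Hermitian form. -/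
@[reducible] def core (β : WeightSeq) : InnerProductSpace.Core ℂ (WeightedHardy β) where
  inner := ip
  conj_inner_symm x y := by
    change conj (ip y x) = ip x y
    rw [ip, ip, Complex.conj_tsum]
    refine tsum_congr (fun n => ?_)
    simp only [map_mul, map_pow, Complex.conj_conj, Complex.conj_ofReal]
    ring
  re_inner_nonneg x := by
    rw [ip_self_eq]
    exact tsum_nonneg (fun n => by positivity)
  add_left x y z := by
    change ip (x + y) z = ip x z + ip y z
    rw [ip, ip, ip, ← (summable_inner x z).tsum_add (summable_inner y z)]
    refine tsum_congr (fun n => ?_)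
    simp only [Submodule.coe_add, map_add]
    ring
  smul_left x y r := by
    change ip (r • x) y = conj r * ip x y
    rw [ip, ip, ← tsum_mul_left]
    refine tsum_congr (fun n => ?_)
    simp only [Submodule.coe_smul, PowerSeries.coeff_smul, smul_eq_mul, map_mul]
    ring
  definite x hx := by
    change ip x x = 0 at hx
    rw [ip_self_eq, Complex.ofReal_eq_zero] at hx
    have hs : Summable fun n => ‖PowerSeries.coeff n x.1‖ ^ 2 * β n ^ 2 := x.2
    have h0 := (hs.hasSum_iff.2 hx)
    rw [hasSum_zero_iff_of_nonneg (fun n => by positivity)] at h0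
    refine Subtype.ext (PowerSeries.ext fun n => ?_)
    have hn := congrFun h0 n
    have hb := β.pos n
    simpa [hb.ne'] using hn

instance : NormedAddCommGroup (WeightedHardy β) :=
  @InnerProductSpace.Core.toNormedAddCommGroup ℂ (WeightedHardy β) _ _ _ (core β)

instance : InnerProductSpace ℂ (WeightedHardy β) :=
  InnerProductSpace.ofCore (core β).toCore

lemma inner_def (g f : WeightedHardy β) : inner ℂ g f =
    ∑' n, conj (PowerSeries.coeff n g.1) * PowerSeries.coeff n f.1 * (β n : ℂ) ^ 2 := rfl

lemma norm_sq_eq (f : WeightedHardy β) :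
    ‖f‖ ^ 2 = ∑' n, ‖PowerSeries.coeff n f.1‖ ^ 2 * β n ^ 2 := by
  have h := inner_self_eq_norm_sq_to_K (𝕜 := ℂ) f
  have h2 : inner ℂ f f = _ := ip_self_eq f
  rw [h2] at h
  apply RCLike.ofReal_injective (K := ℂ)
  rw [RCLike.ofReal_pow]
  exact h.symm

/-- The unitary identification of `H_β` with `ℓ²`, by coordinates in the orthonormal basis
`z ^ n / β n`. -/
def toEll2 (β : WeightSeq) : WeightedHardy β ≃ₗᵢ[ℂ] lp (fun _ : ℕ => ℂ) 2 where
  toFun f := ⟨fun n => PowerSeries.coeff n f.1 * (β n : ℂ), by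
    refine memℓp_gen ?_
    have hf : Summable fun n => ‖PowerSeries.coeff n f.1‖ ^ 2 * β n ^ 2 := f.2
    refine hf.congr (fun n => ?_)
    simp [mul_pow]⟩
  invFun a := ⟨PowerSeries.mk fun n => a n / (β n : ℂ), by
    have ha := (lp.memℓp a).summable (by norm_num)
    refine ha.congr (fun n => ?_)
    have hb := (β.pos n).ne'
    simp [div_pow, hb]⟩
  left_inv f := by
    refine Subtype.ext (PowerSeries.ext fun n => ?_)
    have hb : (β n : ℂ) ≠ 0 := by exact_mod_cast (β.pos n).ne'
    simp [hb]
  right_inv a := by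
    refine lp.ext (funext fun n => ?_)
    have hb : (β n : ℂ) ≠ 0 := by exact_mod_cast (β.pos n).ne'
    simp [hb]
  map_add' f g := by
    refine lp.ext (funext fun n => ?_)
    change PowerSeries.coeff n (f.1 + g.1) * (β n : ℂ) = PowerSeries.coeff n f.1 * (β n : ℂ) +
      PowerSeries.coeff n g.1 * (β n : ℂ)
    rw [map_add, add_mul]
  map_smul' c f := by
    refine lp.ext (funext fun n => ?_)
    simp [mul_assoc]
  norm_map' f := by
    rw [← sq_eq_sq₀ (norm_nonneg _) (norm_nonneg _), norm_sq_eq]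
    have h := lp.norm_rpow_eq_tsum (p := 2) (E := fun _ : ℕ => ℂ) (by norm_num)
      (⟨fun n => PowerSeries.coeff n f.1 * (β n : ℂ), by
        refine memℓp_gen ?_
        have hf : Summable fun n => ‖PowerSeries.coeff n f.1‖ ^ 2 * β n ^ 2 := f.2
        refine hf.congr (fun n => ?_)
        simp [mul_pow]⟩ : lp (fun _ : ℕ => ℂ) 2)
    simp only [ENNReal.toReal_ofNat, Real.rpow_ofNat] at h
    refine h.trans (tsum_congr fun n => ?_)
    simp [mul_pow]

instance : CompleteSpace (WeightedHardy β) :=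
  (toEll2 β).toIsometryEquiv.completeSpace

/-- The polynomials, as a subspace of `H_β`. -/
def polynomials (β : WeightSeq) : Submodule ℂ (WeightedHardy β) where
  carrier := {f | ∃ q : Polynomial ℂ, (q : ℂ⟦X⟧) = f.1}
  zero_mem' := ⟨0, by simp⟩
  add_mem' := by
    rintro f g ⟨q, hq⟩ ⟨r, hr⟩
    exact ⟨q + r, by simp [hq, hr]⟩
  smul_mem' := by
    rintro c f ⟨q, hq⟩
    exact ⟨c • q, by simp [hq]⟩

end WeightedHardy

/-- The Taylor series at `0` of a function `p : ℂ → ℂ`. -/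
def taylorAtZero (p : ℂ → ℂ) : ℂ⟦X⟧ :=
  PowerSeries.mk fun n => iteratedDeriv n p 0 / (n.factorial : ℂ)

/-- The differential expression `L = ∑ k ≤ N, p k * D ^ k`, acting on power series in `z`. -/
def diffExpr (N : ℕ) (p : ℕ → ℂ → ℂ) : ℂ⟦X⟧ →ₗ[ℂ] ℂ⟦X⟧ :=
  ∑ k ∈ Finset.range (N + 1),
    (LinearMap.mulLeft ℂ (taylorAtZero (p k))).comp
      ((PowerSeries.derivative ℂ : ℂ⟦X⟧ →ₗ[ℂ] ℂ⟦X⟧) ^ k)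

/-- The maximal operator: `f ↦ L f` with domain `{f ∈ H_β | L f ∈ H_β}`. -/
def maxOp (β : WeightSeq) (N : ℕ) (p : ℕ → ℂ → ℂ) :
    WeightedHardy β →ₗ.[ℂ] WeightedHardy β where
  domain := (WeightedHardy β).comap ((diffExpr N p).comp (WeightedHardy β).subtype)
  toFun := LinearMap.codRestrict (WeightedHardy β)
    ((diffExpr N p).comp ((WeightedHardy β).subtype.comp (Submodule.subtype _))) fun f => f.2

/-- The minimal operator: `f ↦ L f` on the polynomials (with `L f ∈ H_β`, which is automatic when
the coefficients are analytic on the closed unit disk and the weights are those of interest). -/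
def minOp (β : WeightSeq) (N : ℕ) (p : ℕ → ℂ → ℂ) :
    WeightedHardy β →ₗ.[ℂ] WeightedHardy β :=
  (maxOp β N p).domRestrict (WeightedHardy.polynomials β)

/-- `L = ∑ k ≤ N, p k * D ^ k` is formally symmetric on `H_β`: `⟨L f, g⟩ = ⟨f, L g⟩` for all
polynomials `f`, `g`. -/
def FormallySymmetric (β : WeightSeq) (N : ℕ) (p : ℕ → ℂ → ℂ) : Prop :=
  (minOp β N p).IsFormalAdjoint (minOp β N p)

/-- `L = ∑ k ≤ N, p k * D ^ k` is `𝔻`-regular: its coefficients are analytic on (a neighbourhood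
of) the closed unit disk, and the leading one has no zeros on the unit circle. -/
def DiskRegular (N : ℕ) (p : ℕ → ℂ → ℂ) : Prop :=
  (∀ k ≤ N, AnalyticOnNhd ℂ (p k) (Metric.closedBall 0 1)) ∧ ∀ z : ℂ, ‖z‖ = 1 → p N z ≠ 0

/-- The bounded operator `R` is the resolvent `(T - μ)⁻¹` of `T` at `μ`. -/
def IsResolventAt {H : Type*} [NormedAddCommGroup H] [NormedSpace ℂ H]
    (T : H →ₗ.[ℂ] H) (μ : ℂ) (R : H →L[ℂ] H) : Prop :=
  (∀ g : H, ∃ f : T.domain, (f : H) = R g ∧ T f - μ • (f : H) = g) ∧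
    ∀ f : T.domain, R (T f - μ • (f : H)) = f

/-- The resolvent set of an unbounded operator. -/
def resolventSetOf {H : Type*} [NormedAddCommGroup H] [NormedSpace ℂ H]
    (T : H →ₗ.[ℂ] H) : Set ℂ :=
  {μ | ∃ R : H →L[ℂ] H, IsResolventAt T μ R}

end

/-! In the orthonormal basis `z ^ n / β n`, the operator `L` is a matrix whose entry `(m, n)`
vanishes for `n > m + N`, because `D ^ k` lowers degrees by at most `N`. Formal symmetry makes this
matrix Hermitian, hence a band matrix of half-width `N`. Since `β m / β n = 1 + O(1 / m)` on the
band, the entries are `q (N + m - n) * (m + 1) ^ N` up to an error of order `N - 1`, where `q i` are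
the Taylor coefficients of `p N`. Comparing the Hermitian and band properties at leading order gives
`q i = 0` for `i > 2 * N` and `conj (q i) = q (2 * N - i)`. So `p N` is a polynomial on the closed
disk, and the symbol `exp (-iNt) * p N (exp (it))` is real. By regularity it has no zeros, so it has
constant sign and stays away from `0` (`exists_symbol_lower_bound`).

The leading Toeplitz form is therefore definite (`toeplitz_lower_bound`), which makes `L` elliptic:
the squared norm of `(n + 1) ^ N * f n` is controlled by `‖L f‖ ^ 2 + ‖f‖ ^ 2`
(`elliptic_regularity`, `maxOp_regularity`). Its finiteness is part of the conclusion, so the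
estimate is first proved with the bounded weights `damped ε n ^ N`, with constants independent of
`ε`, and then `ε → 0`.

The rest follows from this regularity. It makes the double series for `⟨L f, g⟩` absolutely
convergent, so `maxOp` is symmetric. Pairing with monomials shows that its adjoint also acts as `L`,
whence self-adjointness. Truncations converge in the graph norm, so the polynomials form a core.
Finally `L (R g) = g + μ • R g` bounds the resolvent into the Sobolev space, and the decay gained
there makes it a norm limit of finite-rank operators. -/

noncomputable section

/-! ### Sums over bands -/

/-- The indices at distance at most `N` from `m`. -/
def band (N m : ℕ) : Finset ℕ := Finset.Icc (m - N) (m + N)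

lemma mem_band {N m n : ℕ} : n ∈ band N m ↔ m ≤ n + N ∧ n ≤ m + N := by
  simp [band]

lemma mem_band_comm {N m n : ℕ} : n ∈ band N m ↔ m ∈ band N n := by
  simp [mem_band, and_comm]

lemma self_mem_band (N m : ℕ) : m ∈ band N m := by simp [mem_band]

lemma card_band_le (N m : ℕ) : (band N m).card ≤ 2 * N + 1 := by
  simp only [band, Nat.card_Icc]; omega

/-- Each index lies in at most `2 * N + 1` bands, and the bands around `m < K` stay inside `range (K
+ N)`. -/
lemma sum_range_band_le (N : ℕ) {h : ℕ → ℝ} (h0 : ∀ n, 0 ≤ h n) (hs : Summable h) (K : ℕ) :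
    ∑ m ∈ Finset.range K, ∑ n ∈ band N m, h n ≤ (2 * N + 1) * ∑' n, h n := by
  have h1 : ∑ m ∈ Finset.range K, ∑ n ∈ band N m, h n =
      ∑ n ∈ Finset.range (K + N), ∑ m ∈ Finset.range K with m ∈ band N n, h n := by
    refine Finset.sum_comm' fun m n => ?_
    simp only [Finset.mem_range, Finset.mem_filter, mem_band]
    omega
  rw [h1, ← tsum_mul_left]
  refine le_trans (Finset.sum_le_sum fun n _ => ?_)
    ((hs.mul_left _).sum_le_tsum (Finset.range (K + N))
      fun n _ => mul_nonneg (by positivity) (h0 n))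
  rw [Finset.sum_const, nsmul_eq_mul]
  refine mul_le_mul_of_nonneg_right ?_ (h0 n)
  have h2 : (Finset.filter (fun m => m ∈ band N n) (Finset.range K)).card ≤ 2 * N + 1 :=
    (Finset.card_le_card fun m hm => (Finset.mem_filter.1 hm).2).trans (card_band_le N n)
  exact_mod_cast h2

lemma summable_band (N : ℕ) {h : ℕ → ℝ} (h0 : ∀ n, 0 ≤ h n) (hs : Summable h) :
    Summable fun m => ∑ n ∈ band N m, h n :=
  summable_of_sum_range_le (fun _ => Finset.sum_nonneg fun n _ => h0 n) (sum_range_band_le N h0 hs)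

lemma tsum_band_le (N : ℕ) {h : ℕ → ℝ} (h0 : ∀ n, 0 ≤ h n) (hs : Summable h) :
    ∑' m, ∑ n ∈ band N m, h n ≤ (2 * N + 1) * ∑' n, h n :=
  Real.tsum_le_of_sum_range_le (fun _ => Finset.sum_nonneg fun n _ => h0 n)
    (sum_range_band_le N h0 hs)

lemma sum_band_const_le (N m : ℕ) {c : ℝ} (hc : 0 ≤ c) :
    ∑ _n ∈ band N m, c ≤ (2 * N + 1) * c := by
  rw [Finset.sum_const, nsmul_eq_mul]
  refine mul_le_mul_of_nonneg_right ?_ hc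
  exact_mod_cast card_band_le N m

lemma tsum_band_comm (N : ℕ) {F : ℕ → ℕ → ℂ} (H : Summable fun m => ∑ n ∈ band N m, ‖F m n‖) :
    ∑' m, ∑ n ∈ band N m, F m n = ∑' n, ∑ m ∈ band N n, F m n := by
  set G : ℕ → ℕ → ℂ := fun m n => if n ∈ band N m then F m n else 0 with hG
  have h1 : ∀ m, ∑' n, G m n = ∑ n ∈ band N m, F m n := fun m => by
    rw [tsum_eq_sum (s := band N m) (fun n hn => if_neg hn)]
    exact Finset.sum_congr rfl fun n hn => if_pos hn
  have h2 : ∀ n, ∑' m, G m n = ∑ m ∈ band N n, F m n := fun n => by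
    rw [tsum_eq_sum (s := band N n) (fun m hm => if_neg fun h => hm (mem_band_comm.1 h))]
    exact Finset.sum_congr rfl fun m hm => if_pos (mem_band_comm.1 hm)
  have h3 : Summable (Function.uncurry G) := by
    refine Summable.of_norm ?_
    rw [summable_prod_of_nonneg fun _ => norm_nonneg _]
    refine ⟨fun m => summable_of_ne_finset_zero (s := band N m) fun n hn => ?_, H.congr fun m => ?_⟩
    · simp [G, hn]
    · rw [tsum_eq_sum (s := band N m) (fun n hn => by simp [G, hn])]
      exact Finset.sum_congr rfl fun n hn => by simp [G, hn]
  simp_rw [← h1, ← h2]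
  exact h3.tsum_comm.symm

/-! ### Damped weights and lower-order errors, uniformly in the damping -/

/-- The function `n ↦ (n + 1) / (1 + ε (n + 1))`, bounded if `ε > 0`. -/
def damped (ε : ℝ) (n : ℕ) : ℝ := ((n : ℝ) + 1) / (1 + ε * ((n : ℝ) + 1))

lemma damped_zero (n : ℕ) : damped 0 n = (n : ℝ) + 1 := by simp [damped]

lemma damped_pos {ε : ℝ} (hε : 0 ≤ ε) (n : ℕ) : 0 < damped ε n := by
  unfold damped; positivity

lemma damped_le {ε : ℝ} (hε : 0 ≤ ε) (n : ℕ) : damped ε n ≤ (n : ℝ) + 1 := by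
  refine div_le_self (by positivity) ?_
  have : 0 ≤ ε * ((n : ℝ) + 1) := by positivity
  linarith

lemma damped_le_inv {ε : ℝ} (hε : 0 < ε) (n : ℕ) : damped ε n ≤ ε⁻¹ := by
  rw [damped, div_le_iff₀ (by positivity)]
  have : ε⁻¹ * (1 + ε * ((n : ℝ) + 1)) = ε⁻¹ + ((n : ℝ) + 1) := by field_simp
  rw [this]
  have : 0 < ε⁻¹ := by positivity
  linarith

lemma succ_le_of_mem_band {N m n : ℕ} (h : n ∈ band N m) :
    (n : ℝ) + 1 ≤ (N + 1) * ((m : ℝ) + 1) := by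
  have h2 : (n : ℝ) ≤ m + N := by exact_mod_cast (mem_band.1 h).2
  nlinarith [(Nat.cast_nonneg m : (0 : ℝ) ≤ m), (Nat.cast_nonneg N : (0 : ℝ) ≤ N)]

/-- The difference has an exact factorisation whose only further dependence on `ε` is a factor at
most `1`. The weights thus vary slowly along the band, with a constant free of `ε`. -/
lemma abs_damped_sub_le {ε : ℝ} (hε : 0 ≤ ε) {N m n : ℕ} (h : n ∈ band N m) :
    |damped ε n - damped ε m| ≤ N * (damped ε m / ((m : ℝ) + 1)) := by
  have h1 : (m : ℝ) ≤ n + N := by exact_mod_cast (mem_band.1 h).1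
  have h2 : (n : ℝ) ≤ m + N := by exact_mod_cast (mem_band.1 h).2
  have e : damped ε n - damped ε m =
      (n - m) * (damped ε m / ((m : ℝ) + 1)) * (1 + ε * ((n : ℝ) + 1))⁻¹ := by
    unfold damped
    have a1 : (1 + ε * ((n : ℝ) + 1)) ≠ 0 := by positivity
    have a2 : (1 + ε * ((m : ℝ) + 1)) ≠ 0 := by positivity
    field_simp
    ring
  have h3 : (1 + ε * ((n : ℝ) + 1))⁻¹ ≤ 1 := by
    refine inv_le_one_of_one_le₀ ?_
    have : 0 ≤ ε * ((n : ℝ) + 1) := by positivity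
    linarith
  have h4 : 0 ≤ damped ε m / ((m : ℝ) + 1) := div_nonneg (damped_pos hε m).le (by positivity)
  rw [e, abs_mul, abs_mul, abs_of_nonneg h4, abs_of_nonneg (by positivity :
    0 ≤ (1 + ε * ((n : ℝ) + 1))⁻¹)]
  have h5 : |(n : ℝ) - m| ≤ N := abs_le.2 ⟨by linarith, by linarith⟩
  calc _ ≤ |(n : ℝ) - m| * (damped ε m / ((m : ℝ) + 1)) * 1 := by gcongr
    _ ≤ _ := by rw [mul_one]; gcongr

lemma damped_le_of_mem_band {ε : ℝ} (hε : 0 ≤ ε) {N m n : ℕ} (h : n ∈ band N m) :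
    damped ε n ≤ (N + 1) * damped ε m := by
  have h1 := (abs_le.1 (abs_damped_sub_le hε h)).2
  have h2 : damped ε m / ((m : ℝ) + 1) ≤ damped ε m :=
    div_le_self (damped_pos hε m).le (by linarith [(Nat.cast_nonneg m : (0 : ℝ) ≤ m)])
  nlinarith [(Nat.cast_nonneg N : (0 : ℝ) ≤ N)]

lemma abs_damped_pow_sub_le {ε : ℝ} (hε : 0 ≤ ε) {N m n : ℕ} (h : n ∈ band N m) (k : ℕ) :
    |damped ε n ^ k - damped ε m ^ k| ≤
      N * k * (N + 1) ^ k * (damped ε m ^ k / ((m : ℝ) + 1)) := by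
  have hd := damped_pos hε m
  rcases k with _ | k
  · simp
  have h0 := abs_pow_sub_pow_le (damped ε n) (damped ε m) (k + 1)
  have h1 : max |damped ε n| |damped ε m| ≤ (N + 1) * damped ε m := by
    rw [abs_of_pos (damped_pos hε n), abs_of_pos hd]
    refine max_le (damped_le_of_mem_band hε h) ?_
    nlinarith [(Nat.cast_nonneg N : (0 : ℝ) ≤ N)]
  have h2 : (1 : ℝ) ≤ N + 1 := by linarith [(Nat.cast_nonneg N : (0 : ℝ) ≤ N)]
  refine h0.trans ?_
  calc _ ≤ N * (damped ε m / ((m : ℝ) + 1)) * ((k + 1 : ℕ) : ℝ) *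
        ((N + 1) * damped ε m) ^ k := by
        rw [Nat.add_sub_cancel]
        have := abs_damped_sub_le hε h
        gcongr
    _ = N * ((k + 1 : ℕ) : ℝ) * (N + 1) ^ k * (damped ε m ^ (k + 1) / ((m : ℝ) + 1)) := by
        rw [mul_pow, pow_succ (damped ε m)]; ring
    _ ≤ _ := by
        have : ((N : ℝ) + 1) ^ k ≤ (N + 1) ^ (k + 1) := pow_le_pow_right₀ h2 (Nat.le_succ k)
        gcongr

lemma damped_pow_le_of_mem_band {ε : ℝ} (hε : 0 ≤ ε) {N m n : ℕ} (h : n ∈ band N m) (k : ℕ) :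
    damped ε n ^ k ≤ (N + 1) ^ k * damped ε m ^ k := by
  rw [← mul_pow]
  exact pow_le_pow_left₀ (damped_pos hε n).le (damped_le_of_mem_band hε h) k

/-- Order `k - 1` is written as a quotient throughout, so that no truncated exponent appears when `k
= 0`. -/
lemma succ_pow_div_le_of_mem_band {W m n : ℕ} (h : n ∈ band W m) (k : ℕ) :
    ((n : ℝ) + 1) ^ k / ((n : ℝ) + 1) ≤
      (W + 1) ^ k * (W + 1) * (((m : ℝ) + 1) ^ k / ((m : ℝ) + 1)) := by
  have hx : (0 : ℝ) < (m : ℝ) + 1 := by positivity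
  have hxn : (0 : ℝ) < (n : ℝ) + 1 := by positivity
  have hmn : (m : ℝ) + 1 ≤ (W + 1) * ((n : ℝ) + 1) := succ_le_of_mem_band (mem_band_comm.1 h)
  have c1 : ((n : ℝ) + 1) ^ k ≤ (W + 1) ^ k * ((m : ℝ) + 1) ^ k := by
    rw [← mul_pow]; exact pow_le_pow_left₀ hxn.le (succ_le_of_mem_band h) k
  have c2 : 1 / ((n : ℝ) + 1) ≤ (W + 1) / ((m : ℝ) + 1) := by
    rw [div_le_div_iff₀ hxn hx]; linarith
  calc ((n : ℝ) + 1) ^ k / ((n : ℝ) + 1) = ((n : ℝ) + 1) ^ k * (1 / ((n : ℝ) + 1)) := by ring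
    _ ≤ ((W + 1) ^ k * ((m : ℝ) + 1) ^ k) * ((W + 1) / ((m : ℝ) + 1)) := by gcongr
    _ = _ := by ring

/-- Two replacements are made, `A` by its leading part and the weight at `n` by the weight at `m`.
Each costs one factor `1 / (m + 1)`, with a constant independent of `ε`. -/
lemma norm_damped_commutator_le {N : ℕ} {A a : ℕ → ℕ → ℂ} {C C' : ℝ} (hC : 0 ≤ C)
    (hA : ∀ m, ∀ n ∈ band N m,
      ‖A m n - a m n * ((m : ℂ) + 1) ^ N‖ ≤ C * (((m : ℝ) + 1) ^ N / ((m : ℝ) + 1)))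
    (ha : ∀ m n, ‖a m n‖ ≤ C') {ε : ℝ} (hε : 0 ≤ ε) {m n : ℕ} (h : n ∈ band N m) :
    ‖A m n * ((damped ε m ^ N * damped ε m ^ N / ((m : ℝ) + 1) ^ N : ℝ) : ℂ) -
        a m n * ((damped ε n ^ N : ℝ) : ℂ) * ((damped ε m ^ N : ℝ) : ℂ)‖ ≤
      (C + C' * (N * N * (N + 1) ^ N)) * (N + 1) ^ N *
        (damped ε m ^ N * damped ε n ^ N / ((m : ℝ) + 1)) := by
  have hC' : 0 ≤ C' := (norm_nonneg _).trans (ha 0 0)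
  set v := damped ε m ^ N with hv
  set w := damped ε n ^ N with hw
  have hv0 : 0 < v := pow_pos (damped_pos hε m) N
  have hw0 : 0 < w := pow_pos (damped_pos hε n) N
  have hx : (0 : ℝ) < (m : ℝ) + 1 := by positivity
  have hxc : ((m : ℂ) + 1) ^ N = ((((m : ℝ) + 1) ^ N : ℝ) : ℂ) := by push_cast; rfl
  have hxN : (0 : ℝ) < ((m : ℝ) + 1) ^ N := by positivity
  have e : A m n * ((v * v / ((m : ℝ) + 1) ^ N : ℝ) : ℂ) - a m n * (w : ℂ) * (v : ℂ) =
      (A m n - a m n * ((m : ℂ) + 1) ^ N) * ((v * v / ((m : ℝ) + 1) ^ N : ℝ) : ℂ) -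
        a m n * ((w - v : ℝ) : ℂ) * (v : ℂ) := by
    have : ((m : ℂ) + 1) ^ N * ((v * v / ((m : ℝ) + 1) ^ N : ℝ) : ℂ) = v * v := by
      rw [hxc, ← Complex.ofReal_mul]
      rw [mul_div_cancel₀ _ hxN.ne']
      push_cast; rfl
    rw [sub_mul, mul_assoc (a m n) (((m : ℂ) + 1) ^ N), this]
    push_cast
    ring
  rw [e]
  have h1 : |w - v| ≤ N * N * (N + 1) ^ N * (v / ((m : ℝ) + 1)) := abs_damped_pow_sub_le hε h N
  have h2 : v ≤ (N + 1) ^ N * w := damped_pow_le_of_mem_band hε (mem_band_comm.1 h) N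
  refine (norm_sub_le _ _).trans ?_
  rw [norm_mul, norm_mul, norm_mul, Complex.norm_real, Complex.norm_real, Complex.norm_real,
    Real.norm_of_nonneg (by positivity : 0 ≤ v * v / ((m : ℝ) + 1) ^ N), Real.norm_of_nonneg hv0.le,
    Real.norm_eq_abs]
  calc _ ≤ C * (((m : ℝ) + 1) ^ N / ((m : ℝ) + 1)) * (v * v / ((m : ℝ) + 1) ^ N) +
        C' * (N * N * (N + 1) ^ N * (v / ((m : ℝ) + 1))) * v := by
        gcongr
        · exact hA m n h
        · exact ha m n
    _ = (C + C' * (N * N * (N + 1) ^ N)) * (v * v / ((m : ℝ) + 1)) := by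
        field_simp
    _ ≤ (C + C' * (N * N * (N + 1) ^ N)) * (v * ((N + 1) ^ N * w) / ((m : ℝ) + 1)) := by
        gcongr
    _ = _ := by ring

/-- If `n + 1 ≥ c / η`, the factor `c / (n + 1)` is at most `η`. For the remaining indices the
weight itself is at most `(c / η) ^ N`. -/
lemma lower_order_absorb {c η : ℝ} (hc : 0 < c) (hη : 0 < η) (N : ℕ) {ε : ℝ} (hε : 0 ≤ ε) (n : ℕ)
    {y : ℝ} (hy : 0 ≤ y) :
    c * (damped ε n ^ N * damped ε n ^ N * y / ((n : ℝ) + 1)) ≤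
      η * (damped ε n ^ N * damped ε n ^ N * y) + c * ((c / η) ^ N * (c / η) ^ N) * y := by
  have hd := pow_pos (damped_pos hε n) N
  have hx : (0 : ℝ) < (n : ℝ) + 1 := by positivity
  rcases le_total (c / η) ((n : ℝ) + 1) with h | h
  · have h1 : c / ((n : ℝ) + 1) ≤ η := by
      rw [div_le_iff₀ hη] at h
      rw [div_le_iff₀ hx]; linarith
    have h2 : c * (damped ε n ^ N * damped ε n ^ N * y / ((n : ℝ) + 1)) =
      c / ((n : ℝ) + 1) * (damped ε n ^ N * damped ε n ^ N * y) := by ring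
    rw [h2]
    have : 0 ≤ c * ((c / η) ^ N * (c / η) ^ N) * y := by positivity
    have : c / ((n : ℝ) + 1) * (damped ε n ^ N * damped ε n ^ N * y) ≤
      η * (damped ε n ^ N * damped ε n ^ N * y) := by gcongr
    linarith
  · have h1 : damped ε n ^ N ≤ (c / η) ^ N :=
      pow_le_pow_left₀ (damped_pos hε n).le ((damped_le hε n).trans h) N
    have h2 : damped ε n ^ N * damped ε n ^ N * y / ((n : ℝ) + 1) ≤
        damped ε n ^ N * damped ε n ^ N * y :=
      div_le_self (by positivity) (by linarith [(Nat.cast_nonneg n : (0 : ℝ) ≤ n)])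
    have h3 : 0 ≤ η * (damped ε n ^ N * damped ε n ^ N * y) := by positivity
    calc _ ≤ c * (damped ε n ^ N * damped ε n ^ N * y) := by gcongr
      _ ≤ c * ((c / η) ^ N * (c / η) ^ N * y) := by gcongr
      _ ≤ _ := by linarith

lemma summable_damped_mul {f : ℕ → ℂ} (hf : Summable fun n => ‖f n‖ ^ 2) (N : ℕ) {ε : ℝ}
    (hε : 0 < ε) : Summable fun n => ‖((damped ε n ^ N : ℝ) : ℂ) * f n‖ ^ 2 := by
  refine Summable.of_nonneg_of_le (fun n => by positivity) (fun n => ?_)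
    (hf.mul_left ((ε⁻¹ ^ N) ^ 2))
  rw [norm_mul, mul_pow, Complex.norm_real,
    Real.norm_of_nonneg (pow_pos (damped_pos hε.le n) N).le]
  have := pow_le_pow_left₀ (damped_pos hε.le n).le (damped_le_inv hε n) N
  have := (pow_pos (damped_pos hε.le n) N).le
  gcongr

lemma summable_band_mul {N : ℕ} {a : ℕ → ℕ → ℂ} {C : ℝ} (ha : ∀ m, ∀ n ∈ band N m, ‖a m n‖ ≤ C)
    {u w : ℕ → ℂ} (hu : Summable fun n => ‖u n‖ ^ 2) (hw : Summable fun n => ‖w n‖ ^ 2) :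
    Summable fun m => ∑ n ∈ band N m, ‖a m n * u n * conj (w m)‖ := by
  have h1 := summable_band N (fun n => by positivity) hu
  have hC : 0 ≤ C := (norm_nonneg _).trans (ha 0 0 (self_mem_band N 0))
  refine Summable.of_nonneg_of_le (fun _ => Finset.sum_nonneg fun _ _ => norm_nonneg _)
    (fun m => ?_) ((h1.add (hw.mul_left (2 * (N : ℝ) + 1))).mul_left C)
  calc _ ≤ ∑ n ∈ band N m, C * (‖u n‖ ^ 2 + ‖w m‖ ^ 2) := by
        refine Finset.sum_le_sum fun n hn => ?_
        rw [norm_mul, norm_mul, RCLike.norm_conj, mul_assoc]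
        refine mul_le_mul (ha m n hn) ?_ (by positivity) hC
        nlinarith [sq_nonneg (‖u n‖ - ‖w m‖), sq_nonneg (‖u n‖ + ‖w m‖)]
    _ ≤ _ := by
        rw [← Finset.mul_sum, Finset.sum_add_distrib]
        have := sum_band_const_le N m (sq_nonneg ‖w m‖)
        gcongr

/-! ### Elliptic estimate and regularity for band matrices -/

/-- A priori estimate for a band matrix of order `N` whose leading part is a Toeplitz matrix
that is positive definite up to a scalar. -/
theorem damped_elliptic_estimate {N : ℕ} {A a : ℕ → ℕ → ℂ} {C C' δ : ℝ} {θ : ℂ} (hC : 0 < C)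
    (hδ : 0 < δ) (hθ : ‖θ‖ ≤ 1)
    (hA : ∀ m, ∀ n ∈ band N m,
      ‖A m n - a m n * ((m : ℂ) + 1) ^ N‖ ≤ C * (((m : ℝ) + 1) ^ N / ((m : ℝ) + 1)))
    (ha : ∀ m n, ‖a m n‖ ≤ C')
    (hpos : ∀ u : ℕ → ℂ, (Summable fun n => ‖u n‖ ^ 2) →
      δ * ∑' n, ‖u n‖ ^ 2 ≤ (θ * ∑' m, ∑ n ∈ band N m, a m n * u n * conj (u m)).re) :
    ∃ K : ℝ, 0 ≤ K ∧ ∀ f : ℕ → ℂ, (Summable fun n => ‖f n‖ ^ 2) →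
      (Summable fun m => ‖∑ n ∈ band N m, A m n * f n‖ ^ 2) → ∀ ε : ℝ, 0 < ε →
      ∑' n, ‖((damped ε n ^ N : ℝ) : ℂ) * f n‖ ^ 2 ≤
        K * (∑' m, ‖∑ n ∈ band N m, A m n * f n‖ ^ 2 + ∑' n, ‖f n‖ ^ 2) := by
  have hC' : 0 ≤ C' := (norm_nonneg _).trans (ha 0 0)
  set C1 : ℝ := (C + C' * (N * N * (N + 1) ^ N)) * (N + 1) ^ N with hC1
  have hC1p : 0 < C1 := by positivity
  -- The factor `N + 1` moves `1 / (m + 1)` to `1 / (n + 1)` within a band, and the factors `2 * N +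
  -- 1` count indices in a band.
  set C3 : ℝ := C1 * ((N + 1) * (2 * N + 1) + (2 * N + 1)) with hC3
  have hC3p : 0 < C3 := by positivity
  -- This is the constant of `lower_order_absorb` for `c = C3` and `η = δ / 4`.
  set C4 : ℝ := C3 * ((C3 / (δ / 4)) ^ N * (C3 / (δ / 4)) ^ N) with hC4
  have hC4p : 0 < C4 := by positivity
  refine ⟨2 / δ * (1 / δ + C4), by positivity, fun f hf hg ε hε => ?_⟩
  set v : ℕ → ℝ := fun n => damped ε n ^ N with hv
  have hv0 : ∀ n, 0 < v n := fun n => pow_pos (damped_pos hε.le n) N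
  set u : ℕ → ℂ := fun n => ((v n : ℝ) : ℂ) * f n with hu
  set g : ℕ → ℂ := fun m => ∑ n ∈ band N m, A m n * f n with hgdef
  have hun : ∀ n, ‖u n‖ = v n * ‖f n‖ := fun n => by
    rw [hu]; simp only [norm_mul, Complex.norm_real, Real.norm_of_nonneg (hv0 n).le]
  have hus : Summable fun n => ‖u n‖ ^ 2 := summable_damped_mul hf N hε
  set h : ℕ → ℝ := fun n => ‖u n‖ ^ 2 / ((n : ℝ) + 1) with hh
  have hh0 : ∀ n, 0 ≤ h n := fun n => by positivity
  have hhs : Summable h := Summable.of_nonneg_of_le hh0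
    (fun n => div_le_self (by positivity) (by linarith [(Nat.cast_nonneg n : (0 : ℝ) ≤ n)])) hus
  set P : ℕ → ℂ := fun m => ∑ n ∈ band N m, a m n * u n * conj (u m) with hP
  -- The equation is tested against `v m ^ 2 / (m + 1) ^ N * f m`. The denominator cancels the
  -- growth of `A`, so `∑ G` agrees with the Toeplitz form `∑ P` of `u` up to lower order.
  set G : ℕ → ℂ := fun m => g m * ((v m * v m / ((m : ℝ) + 1) ^ N : ℝ) : ℂ) * conj (f m) with hG
  have hdiff : ∀ m, ‖G m - P m‖ ≤
      C1 * ((N + 1) * ∑ n ∈ band N m, h n + (2 * N + 1) * h m) := fun m => by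
    have e : G m - P m = ∑ n ∈ band N m, (A m n *
        ((v m * v m / ((m : ℝ) + 1) ^ N : ℝ) : ℂ) - a m n * (v n : ℂ) * (v m : ℂ)) *
          (f n * conj (f m)) := by
      simp only [hG, hP, hgdef, hu, map_mul, Complex.conj_ofReal]
      rw [Finset.sum_mul, Finset.sum_mul, ← Finset.sum_sub_distrib]
      exact Finset.sum_congr rfl fun n _ => by ring
    rw [e]
    calc _ ≤ ∑ n ∈ band N m, C1 * ((N + 1) * h n + h m) := by
          refine norm_sum_le_of_le _ fun n hn => ?_
          rw [norm_mul, norm_mul, RCLike.norm_conj]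
          have k1 := norm_damped_commutator_le hC.le hA ha hε.le hn
          have k2 : ‖u n‖ ^ 2 / ((m : ℝ) + 1) ≤ (N + 1) * h n := by
            have := succ_le_of_mem_band hn
            simp only [hh]
            rw [div_le_iff₀ (by positivity)]
            have k3 : (1 : ℝ) ≤ (N + 1) * ((m : ℝ) + 1) / ((n : ℝ) + 1) := by
              rw [le_div_iff₀ (by positivity)]; linarith
            calc ‖u n‖ ^ 2 = ‖u n‖ ^ 2 * 1 := (mul_one _).symm
              _ ≤ ‖u n‖ ^ 2 * ((N + 1) * ((m : ℝ) + 1) / ((n : ℝ) + 1)) := by gcongr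
              _ = _ := by ring
          calc _ ≤ C1 * (v m * v n / ((m : ℝ) + 1)) * (‖f n‖ * ‖f m‖) := by gcongr
            _ = C1 * (‖u n‖ * ‖u m‖ / ((m : ℝ) + 1)) := by rw [hun, hun]; ring
            _ ≤ C1 * ((‖u n‖ ^ 2 + ‖u m‖ ^ 2) / ((m : ℝ) + 1)) := by
                gcongr
                nlinarith [sq_nonneg (‖u n‖ - ‖u m‖), sq_nonneg (‖u n‖ + ‖u m‖)]
            _ = C1 * (‖u n‖ ^ 2 / ((m : ℝ) + 1) + h m) := by simp only [hh]; ring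
            _ ≤ _ := by gcongr
      _ ≤ _ := by
          rw [← Finset.mul_sum, Finset.sum_add_distrib, ← Finset.mul_sum]
          have := sum_band_const_le N m (hh0 m)
          gcongr
  have hbs := summable_band N hh0 hhs
  have hEs : Summable fun m => C1 * ((N + 1) * ∑ n ∈ band N m, h n + (2 * N + 1) * h m) :=
    ((hbs.mul_left _).add (hhs.mul_left _)).mul_left _
  have hEt : ∑' m, C1 * ((N + 1) * ∑ n ∈ band N m, h n + (2 * N + 1) * h m) ≤ C3 * ∑' n, h n := by
    rw [tsum_mul_left, (hbs.mul_left _).tsum_add (hhs.mul_left _), tsum_mul_left, tsum_mul_left,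
      hC3, mul_assoc C1]
    refine mul_le_mul_of_nonneg_left ?_ hC1p.le
    have h1 := mul_le_mul_of_nonneg_left (tsum_band_le N hh0 hhs)
      (by positivity : (0 : ℝ) ≤ N + 1)
    linarith
  have hDs : Summable fun m => G m - P m := Summable.of_norm_bounded hEs hdiff
  have hGn : ∀ m, ‖G m‖ ≤ 1 / δ * ‖g m‖ ^ 2 + δ / 4 * ‖u m‖ ^ 2 := fun m => by
    -- Since `v m ≤ (m + 1) ^ N`, the test sequence is no larger than `u`. Young's inequality then
    -- costs only `δ / 4` of the norm of `u`.
    have k1 : v m * v m / ((m : ℝ) + 1) ^ N ≤ v m := by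
      rw [div_le_iff₀ (by positivity)]
      exact mul_le_mul_of_nonneg_left
        (pow_le_pow_left₀ (damped_pos hε.le m).le (damped_le hε.le m) N) (hv0 m).le
    have k2 : ‖G m‖ ≤ ‖g m‖ * ‖u m‖ := by
      simp only [hG, norm_mul, RCLike.norm_conj, Complex.norm_real]
      rw [Real.norm_of_nonneg (div_nonneg (mul_nonneg (hv0 m).le (hv0 m).le) (by positivity)), hun,
        mul_assoc]
      gcongr
    refine k2.trans ?_
    have k3 : 1 / δ * ‖g m‖ ^ 2 + δ / 4 * ‖u m‖ ^ 2 - ‖g m‖ * ‖u m‖ =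
        1 / δ * (‖g m‖ - δ / 2 * ‖u m‖) ^ 2 := by field_simp; ring
    have : 0 ≤ 1 / δ * (‖g m‖ - δ / 2 * ‖u m‖) ^ 2 := by positivity
    linarith
  have hGbs : Summable fun m => 1 / δ * ‖g m‖ ^ 2 + δ / 4 * ‖u m‖ ^ 2 :=
    (hg.mul_left _).add (hus.mul_left _)
  have hGs : Summable G := Summable.of_norm_bounded hGbs hGn
  have hGt : ‖∑' m, G m‖ ≤ 1 / δ * ∑' m, ‖g m‖ ^ 2 + δ / 4 * ∑' m, ‖u m‖ ^ 2 := by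
    rw [← tsum_mul_left, ← tsum_mul_left, ← (hg.mul_left _).tsum_add (hus.mul_left _)]
    exact tsum_of_norm_bounded hGbs.hasSum hGn
  have hDt : ‖∑' m, (G m - P m)‖ ≤ C3 * ∑' n, h n :=
    (tsum_of_norm_bounded hEs.hasSum hdiff).trans hEt
  have hht : C3 * ∑' n, h n ≤ δ / 4 * ∑' n, ‖u n‖ ^ 2 + C4 * ∑' n, ‖f n‖ ^ 2 := by
    rw [← tsum_mul_left, ← tsum_mul_left, ← tsum_mul_left,
      ← (hus.mul_left _).tsum_add (hf.mul_left _)]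
    refine (hhs.mul_left _).tsum_le_tsum (fun n => ?_) ((hus.mul_left _).add (hf.mul_left _))
    have k := lower_order_absorb hC3p (show 0 < δ / 4 by positivity) N hε.le n (sq_nonneg ‖f n‖)
    have e1 : ‖u n‖ ^ 2 = damped ε n ^ N * damped ε n ^ N * ‖f n‖ ^ 2 := by rw [hun, hv]; ring
    simp only [hh, e1]
    exact k
  have hmain := hpos u hus
  have hPe : ∑' m, P m = ∑' m, G m - ∑' m, (G m - P m) := by
    rw [← hGs.tsum_sub hDs]
    exact tsum_congr fun m => by ring
  have hre : (θ * ∑' m, P m).re ≤ ‖∑' m, G m‖ + ‖∑' m, (G m - P m)‖ := by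
    refine (Complex.re_le_norm _).trans ?_
    rw [norm_mul, hPe]
    refine (mul_le_of_le_one_left (norm_nonneg _) hθ).trans (norm_sub_le _ _)
  -- The two contributions `δ / 4` are moved to the left. This is legitimate because `∑ ‖u n‖ ^ 2`
  -- is finite for `ε > 0`.
  have hfin : δ / 2 * ∑' n, ‖u n‖ ^ 2 ≤ 1 / δ * ∑' m, ‖g m‖ ^ 2 + C4 * ∑' n, ‖f n‖ ^ 2 := by
    linarith
  have hg0 : 0 ≤ ∑' m, ‖g m‖ ^ 2 := tsum_nonneg fun _ => by positivity
  have hf0 : 0 ≤ ∑' m, ‖f m‖ ^ 2 := tsum_nonneg fun _ => by positivity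
  have h1 : ∑' n, ‖u n‖ ^ 2 = 2 / δ * (δ / 2 * ∑' n, ‖u n‖ ^ 2) := by field_simp
  rw [h1, mul_assoc (2 / δ)]
  refine mul_le_mul_of_nonneg_left (hfin.trans ?_) (by positivity)
  have : 0 ≤ 1 / δ := by positivity
  nlinarith [mul_nonneg this hf0, mul_nonneg hC4p.le hg0]

/-- Regularity for a band matrix of order `N` with elliptic leading Toeplitz part. -/
theorem elliptic_regularity {N : ℕ} {A a : ℕ → ℕ → ℂ} {C C' δ : ℝ} {θ : ℂ} (hC : 0 < C)
    (hδ : 0 < δ) (hθ : ‖θ‖ ≤ 1)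
    (hA : ∀ m, ∀ n ∈ band N m,
      ‖A m n - a m n * ((m : ℂ) + 1) ^ N‖ ≤ C * (((m : ℝ) + 1) ^ N / ((m : ℝ) + 1)))
    (ha : ∀ m n, ‖a m n‖ ≤ C')
    (hpos : ∀ u : ℕ → ℂ, (Summable fun n => ‖u n‖ ^ 2) →
      δ * ∑' n, ‖u n‖ ^ 2 ≤ (θ * ∑' m, ∑ n ∈ band N m, a m n * u n * conj (u m)).re) :
    ∃ K : ℝ, 0 ≤ K ∧ ∀ f : ℕ → ℂ, (Summable fun n => ‖f n‖ ^ 2) →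
      (Summable fun m => ‖∑ n ∈ band N m, A m n * f n‖ ^ 2) →
      (Summable fun n : ℕ => (((n : ℝ) + 1) ^ N * ‖f n‖) ^ 2) ∧
      ∑' n : ℕ, (((n : ℝ) + 1) ^ N * ‖f n‖) ^ 2 ≤
        K * (∑' m, ‖∑ n ∈ band N m, A m n * f n‖ ^ 2 + ∑' n, ‖f n‖ ^ 2) := by
  obtain ⟨K, hK, H⟩ := damped_elliptic_estimate hC hδ hθ hA ha hpos
  refine ⟨K, hK, fun f hf hg => ?_⟩
  -- On a finite set of indices `ε → 0` is a plain limit. Since the bound does not depend on the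
  -- set, it gives both summability and the estimate.
  have key : ∀ s : Finset ℕ, ∑ n ∈ s, (((n : ℝ) + 1) ^ N * ‖f n‖) ^ 2 ≤
      K * (∑' m, ‖∑ n ∈ band N m, A m n * f n‖ ^ 2 + ∑' n, ‖f n‖ ^ 2) := fun s => by
    have ht : Filter.Tendsto (fun ε : ℝ => ∑ n ∈ s, (damped ε n ^ N * ‖f n‖) ^ 2)
        (nhdsWithin 0 (Set.Ioi 0)) (nhds (∑ n ∈ s, (damped 0 n ^ N * ‖f n‖) ^ 2)) := by
      refine Filter.Tendsto.mono_left ?_ nhdsWithin_le_nhds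
      refine tendsto_finsetSum _ fun n _ => ?_
      refine ((Filter.Tendsto.pow ?_ N).mul_const _).pow 2
      have : ContinuousAt (fun ε : ℝ => damped ε n) 0 := by
        unfold damped
        refine ContinuousAt.div (by fun_prop) (by fun_prop) (by simp)
      exact this
    simp only [damped_zero] at ht
    refine le_of_tendsto ht ?_
    filter_upwards [self_mem_nhdsWithin] with ε hε
    refine le_trans ?_ (H f hf hg ε hε)
    have hs := summable_damped_mul hf N hε
    refine le_trans (le_of_eq ?_) (hs.sum_le_tsum s fun n _ => by positivity)
    refine Finset.sum_congr rfl fun n _ => ?_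
    rw [norm_mul, Complex.norm_real,
      Real.norm_of_nonneg (pow_pos (damped_pos (le_of_lt hε) n) N).le]
  exact ⟨summable_of_sum_le (fun n => by positivity) key,
    Real.tsum_le_of_sum_le (fun n => by positivity) key⟩

/-! ### Toeplitz forms and their symbols -/

lemma integral_exp_int_mul (k : ℤ) :
    ∫ t in (0 : ℝ)..(2 * Real.pi), Complex.exp ((k : ℂ) * Complex.I * t) =
      if k = 0 then 2 * (Real.pi : ℂ) else 0 := by
  split_ifs with h
  · simp [h]
  · have hc : (k : ℂ) * Complex.I ≠ 0 := mul_ne_zero (by exact_mod_cast h) Complex.I_ne_zero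
    rw [integral_exp_mul_complex hc]
    have : (k : ℂ) * Complex.I * ((2 * Real.pi : ℝ) : ℂ) = k * (2 * Real.pi * Complex.I) := by
      push_cast; ring
    rw [this, Complex.exp_int_mul_two_pi_mul_I]
    simp

/-- The trigonometric polynomial `∑ i ≤ 2N, q i * exp (i t (i - N))`. -/
def trigPoly (N : ℕ) (q : ℕ → ℂ) (t : ℝ) : ℂ :=
  ∑ i ∈ Finset.range (2 * N + 1), q i * Complex.exp ((((i : ℤ) - N : ℤ) : ℂ) * Complex.I * t)

lemma continuous_trigPoly (N : ℕ) (q : ℕ → ℂ) : Continuous (trigPoly N q) := by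
  unfold trigPoly
  fun_prop

/-- Quadratic form of a finite section of a Toeplitz band matrix as an integral of its symbol. -/
lemma integral_trigPoly_mul (N K : ℕ) (q u : ℕ → ℂ) (hu : ∀ n, K ≤ n → u n = 0) :
    ∫ t in (0 : ℝ)..(2 * Real.pi), trigPoly N q t *
      (Complex.normSq (∑ n ∈ Finset.range K, u n * Complex.exp (((n : ℤ) : ℂ) * Complex.I * t)) : ℂ)
      = 2 * Real.pi * ∑ m ∈ Finset.range K, ∑ n ∈ band N m, q (N + m - n) * u n * conj (u m) := by
  have e : ∀ t : ℝ, trigPoly N q t *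
      (Complex.normSq (∑ n ∈ Finset.range K, u n * Complex.exp (((n : ℤ) : ℂ) * Complex.I * t)) : ℂ)
      = ∑ m ∈ Finset.range K, ∑ n ∈ Finset.range K, ∑ i ∈ Finset.range (2 * N + 1),
        q i * u n * conj (u m) *
          Complex.exp ((((i : ℤ) - N + n - m : ℤ) : ℂ) * Complex.I * t) := fun t => by
    rw [Complex.normSq_eq_conj_mul_self, trigPoly, map_sum, Finset.sum_mul_sum, Finset.mul_sum]
    refine Finset.sum_congr rfl fun m _ => ?_
    rw [Finset.mul_sum]
    refine Finset.sum_congr rfl fun n _ => ?_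
    rw [Finset.sum_mul]
    refine Finset.sum_congr rfl fun i _ => ?_
    have hc : conj (Complex.exp (((m : ℤ) : ℂ) * Complex.I * t)) =
        Complex.exp (((-m : ℤ) : ℂ) * Complex.I * t) := by
      rw [← Complex.exp_conj]
      congr 1
      simp
    rw [map_mul, hc]
    have hx : Complex.exp ((((i : ℤ) - N + n - m : ℤ) : ℂ) * Complex.I * t) =
        Complex.exp ((((i : ℤ) - N : ℤ) : ℂ) * Complex.I * t) *
          Complex.exp (((n : ℤ) : ℂ) * Complex.I * t) *
          Complex.exp (((-m : ℤ) : ℂ) * Complex.I * t) := by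
      rw [← Complex.exp_add, ← Complex.exp_add]
      congr 1
      push_cast
      ring
    rw [hx]
    ring
  simp_rw [e]
  rw [intervalIntegral.integral_finsetSum, Finset.mul_sum]
  swap
  · exact fun m _ => Continuous.intervalIntegrable (by fun_prop) _ _
  refine Finset.sum_congr rfl fun m hm => ?_
  rw [intervalIntegral.integral_finsetSum]
  swap
  · exact fun m _ => Continuous.intervalIntegrable (by fun_prop) _ _
  have h1 : ∀ n ∈ Finset.range K, ∫ t in (0 : ℝ)..(2 * Real.pi),
      ∑ i ∈ Finset.range (2 * N + 1), q i * u n * conj (u m) *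
          Complex.exp ((((i : ℤ) - N + n - m : ℤ) : ℂ) * Complex.I * t) =
      if n ∈ band N m then 2 * Real.pi * (q (N + m - n) * u n * conj (u m)) else 0 := fun n _ => by
    rw [intervalIntegral.integral_finsetSum]
    swap
    · exact fun i _ => Continuous.intervalIntegrable (by fun_prop) _ _
    simp_rw [intervalIntegral.integral_const_mul, integral_exp_int_mul]
    split_ifs with hb
    · rw [mem_band] at hb
      -- Orthogonality of the exponentials keeps only `i - N + n - m = 0`. On the band this
      -- subtraction is not truncated, and `i` stays in range.
      rw [Finset.sum_eq_single (N + m - n)]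
      · rw [if_pos (by omega)]; ring
      · intro i _ hi
        rw [if_neg (by omega), mul_zero]
      · intro hi
        exact absurd (Finset.mem_range.2 (by omega)) hi
    · refine Finset.sum_eq_zero fun i hi => ?_
      rw [Finset.mem_range] at hi
      rw [if_neg, mul_zero]
      intro h0
      exact hb (mem_band.2 (by omega))
  rw [Finset.sum_congr rfl h1, ← Finset.sum_filter, Finset.mul_sum]
  refine Finset.sum_subset (fun n hn => (Finset.mem_filter.1 hn).2) fun n hn hn' => ?_
  rw [hu n, mul_zero, zero_mul, mul_zero]
  by_contra hlt
  exact hn' (Finset.mem_filter.2 ⟨Finset.mem_range.2 (by omega), hn⟩)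

lemma toeplitz_lower_bound_of_finite {N K : ℕ} {q : ℕ → ℂ} {δ : ℝ} {θ : ℂ}
    (hs : ∀ t, δ ≤ (θ * trigPoly N q t).re) {u : ℕ → ℂ} (hu : ∀ n, K ≤ n → u n = 0) :
    δ * ∑ n ∈ Finset.range K, ‖u n‖ ^ 2 ≤
      (θ * ∑ m ∈ Finset.range K, ∑ n ∈ band N m, q (N + m - n) * u n * conj (u m)).re := by
  set U : ℝ → ℝ := fun t => Complex.normSq
    (∑ n ∈ Finset.range K, u n * Complex.exp (((n : ℤ) : ℂ) * Complex.I * t)) with hU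
  have hUc : Continuous U := Complex.continuous_normSq.comp (by fun_prop)
  have hsc := continuous_trigPoly N q
  have h1 := integral_trigPoly_mul N K q u hu
  -- With `N = 0` and constant symbol `1`, the same identity is Parseval's formula.
  have h2 := integral_trigPoly_mul 0 K (fun _ => 1) u hu
  have hpi : (0 : ℝ) < 2 * Real.pi := by positivity
  have h3 : ∫ t in (0 : ℝ)..(2 * Real.pi), U t = 2 * Real.pi * ∑ n ∈ Finset.range K, ‖u n‖ ^ 2 := by
    have e : ∀ t, trigPoly 0 (fun _ => 1) t = 1 := fun t => by simp [trigPoly]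
    simp_rw [e, one_mul] at h2
    rw [intervalIntegral.integral_ofReal] at h2
    have : ∀ m, band 0 m = {m} := fun m => by simp [band]
    simp_rw [this, Finset.sum_singleton] at h2
    apply Complex.ofReal_injective
    rw [h2]
    push_cast
    congr 1
    refine Finset.sum_congr rfl fun n _ => ?_
    rw [Complex.mul_conj, Complex.normSq_eq_norm_sq]
    push_cast
    rfl
  have h4 : ∫ t in (0 : ℝ)..(2 * Real.pi), (θ * trigPoly N q t).re * U t =
      2 * Real.pi *
        (θ * ∑ m ∈ Finset.range K, ∑ n ∈ band N m, q (N + m - n) * u n * conj (u m)).re := by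
    have e : ∀ t, (θ * trigPoly N q t).re * U t =
        Complex.reCLM (θ * (trigPoly N q t * (U t : ℂ))) := fun t => by
      rw [Complex.reCLM_apply, ← mul_assoc, Complex.re_mul_ofReal]
    simp_rw [e]
    rw [ContinuousLinearMap.intervalIntegral_comp_comm, intervalIntegral.integral_const_mul, h1,
      Complex.reCLM_apply]
    · have : (2 * (Real.pi : ℂ)) = ((2 * Real.pi : ℝ) : ℂ) := by push_cast; rfl
      rw [this, mul_left_comm, Complex.re_ofReal_mul]
    · exact (by fun_prop : Continuous fun t => θ * (trigPoly N q t * (U t : ℂ))).intervalIntegrable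
        _ _
  have h5 : ∫ t in (0 : ℝ)..(2 * Real.pi), δ * U t ≤
      ∫ t in (0 : ℝ)..(2 * Real.pi), (θ * trigPoly N q t).re * U t := by
    refine intervalIntegral.integral_mono_on hpi.le ?_ ?_ fun t _ => ?_
    · exact (by fun_prop : Continuous fun t => δ * U t).intervalIntegrable _ _
    · refine Continuous.intervalIntegrable ?_ _ _
      exact (Complex.continuous_re.comp (continuous_const.mul hsc)).mul hUc
    · exact mul_le_mul_of_nonneg_right (hs t) (Complex.normSq_nonneg _)
  rw [intervalIntegral.integral_const_mul, h3, h4] at h5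
  have h6 : 2 * Real.pi * (δ * ∑ n ∈ Finset.range K, ‖u n‖ ^ 2) ≤ 2 * Real.pi *
        (θ * ∑ m ∈ Finset.range K, ∑ n ∈ band N m, q (N + m - n) * u n * conj (u m)).re := by
    linarith
  exact le_of_mul_le_mul_left h6 hpi

/-- Lower bound of a Toeplitz band form by the minimum of its symbol. -/
theorem toeplitz_lower_bound {N : ℕ} {q : ℕ → ℂ} {C δ : ℝ} {θ : ℂ} (hq : ∀ i, ‖q i‖ ≤ C)
    (hs : ∀ t, δ ≤ (θ * trigPoly N q t).re) {u : ℕ → ℂ} (hu : Summable fun n => ‖u n‖ ^ 2) :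
    δ * ∑' n, ‖u n‖ ^ 2 ≤
      (θ * ∑' m, ∑ n ∈ band N m, q (N + m - n) * u n * conj (u m)).re := by
  -- The finite sections satisfy the bound with the same `δ`, and dominated convergence carries it
  -- to the limit.
  set w : ℕ → ℕ → ℂ := fun K n => if n < K then u n else 0 with hw
  have hwn : ∀ K n, ‖w K n‖ ≤ ‖u n‖ := fun K n => by
    simp only [hw]; split_ifs <;> simp
  have hwlim : ∀ n, Filter.Tendsto (fun K => w K n) Filter.atTop (nhds (u n)) := fun n => by
    refine tendsto_const_nhds.congr' ?_
    filter_upwards [Filter.eventually_gt_atTop n] with K hK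
    simp [hw, hK]
  have hb := summable_band_mul (N := N) (a := fun m n => q (N + m - n)) (C := C)
    (fun m n _ => hq _) hu hu
  have hlim : Filter.Tendsto
      (fun K => ∑' m, ∑ n ∈ band N m, q (N + m - n) * w K n * conj (w K m)) Filter.atTop
      (nhds (∑' m, ∑ n ∈ band N m, q (N + m - n) * u n * conj (u m))) := by
    refine tendsto_tsum_of_dominated_convergence hb (fun m => ?_)
      (Filter.Eventually.of_forall fun K m => ?_)
    · refine tendsto_finsetSum _ fun n _ => ?_
      exact ((hwlim n).const_mul _).mul ((Complex.continuous_conj.tendsto _).comp (hwlim m))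
    · refine norm_sum_le_of_le _ fun n _ => ?_
      simp only [norm_mul, RCLike.norm_conj]
      have := hwn K n
      have := hwn K m
      gcongr
  have hL := (hu.hasSum.tendsto_sum_nat).const_mul δ
  have hR := (Complex.continuous_re.tendsto _).comp (hlim.const_mul θ)
  refine le_of_tendsto_of_tendsto' hL hR fun K => ?_
  have h0 : ∀ n, K ≤ n → w K n = 0 := fun n hn => if_neg (by omega)
  have h := toeplitz_lower_bound_of_finite hs h0
  have h1 : ∑ n ∈ Finset.range K, ‖w K n‖ ^ 2 = ∑ n ∈ Finset.range K, ‖u n‖ ^ 2 :=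
    Finset.sum_congr rfl fun n hn => by simp [hw, Finset.mem_range.1 hn]
  rw [h1] at h
  simp only [Function.comp]
  rwa [tsum_eq_sum (s := Finset.range K)]
  intro m hm
  refine Finset.sum_eq_zero fun n _ => ?_
  rw [h0 m (by simpa using hm), map_zero, mul_zero]

/-! ### Taylor coefficients and the action of `L` on monomials -/

lemma exists_norm_coeff_taylorAtZero_le {p : ℂ → ℂ}
    (hp : AnalyticOnNhd ℂ p (Metric.closedBall 0 1)) :
    ∃ C r : ℝ, 0 ≤ C ∧ 0 < r ∧ r < 1 ∧
      ∀ i, ‖PowerSeries.coeff i (taylorAtZero p)‖ ≤ C * r ^ i := by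
  -- By compactness `p` is analytic on a disk of radius `1 + η`. Cauchy's estimates on its boundary
  -- give the ratio `r = (1 + η)⁻¹`.
  obtain ⟨η, hη, hsub⟩ := (isCompact_closedBall (0 : ℂ) 1).exists_cthickening_subset_open
    (isOpen_analyticAt ℂ p) (fun z hz => hp z hz)
  rw [cthickening_closedBall hη.le zero_le_one] at hsub
  have hR : (0 : ℝ) < η + 1 := by linarith
  have hd : DifferentiableOn ℂ p (Metric.closedBall 0 (η + 1)) := fun z hz =>
    (hsub hz).differentiableAt.differentiableWithinAt
  obtain ⟨C, hC⟩ := (isCompact_sphere (0 : ℂ) (η + 1)).exists_bound_of_continuousOn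
    (hd.continuousOn.mono Metric.sphere_subset_closedBall)
  have hcl : DiffContOnCl ℂ p (Metric.ball 0 (η + 1)) := by
    refine DifferentiableOn.diffContOnCl ?_
    rwa [closure_ball _ hR.ne']
  refine ⟨|C|, (η + 1)⁻¹, abs_nonneg _, by positivity, inv_lt_one_of_one_lt₀ (by linarith),
    fun i => ?_⟩
  have h := Complex.norm_iteratedDeriv_le_of_forall_mem_sphere_norm_le i hR hcl
    fun z hz => (hC z hz).trans (le_abs_self C)
  have hf : (0 : ℝ) < i.factorial := by exact_mod_cast i.factorial_pos
  rw [taylorAtZero, PowerSeries.coeff_mk, norm_div, Complex.norm_natCast, div_le_iff₀ hf]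
  refine h.trans (le_of_eq ?_)
  rw [inv_pow]
  field_simp

/-- A function analytic on the closed unit disk with a terminating Taylor series is a polynomial. -/
lemma eq_sum_of_taylorAtZero_finite {p : ℂ → ℂ}
    (hp : AnalyticOnNhd ℂ p (Metric.closedBall 0 1)) {d : ℕ}
    (hd : ∀ i, d ≤ i → PowerSeries.coeff i (taylorAtZero p) = 0) {z : ℂ} (hz : ‖z‖ ≤ 1) :
    p z = ∑ i ∈ Finset.range d, PowerSeries.coeff i (taylorAtZero p) * z ^ i := by
  have h0 : AnalyticAt ℂ p 0 := hp 0 (by simp)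
  have hq : AnalyticOnNhd ℂ
      (fun z => ∑ i ∈ Finset.range d, PowerSeries.coeff i (taylorAtZero p) * z ^ i)
      (Metric.closedBall 0 1) := by
    intro w _
    fun_prop
  refine hp.eqOn_of_preconnected_of_eventuallyEq hq
    (convex_closedBall (0 : ℂ) 1).isPreconnected (show (0 : ℂ) ∈ _ by simp) ?_
    (show z ∈ Metric.closedBall (0 : ℂ) 1 by simpa using hz)
  filter_upwards [h0.hasFPowerSeriesAt.eventually_hasSum] with w hw
  simp only [zero_add] at hw
  have hw' : HasSum (fun i => PowerSeries.coeff i (taylorAtZero p) * w ^ i) (p w) := by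
    refine hw.congr_fun ?_
    intro i
    simp [taylorAtZero, FormalMultilinearSeries.ofScalars, mul_comm]
  refine hw'.unique (hasSum_sum_of_ne_finset_zero fun i hi => ?_)
  rw [hd i (by simpa using hi), zero_mul]

/-- The coefficient of `z ^ m` in `L z ^ n`. -/
def diffCoeff (N : ℕ) (p : ℕ → ℂ → ℂ) (m n : ℕ) : ℂ :=
  ∑ k ∈ Finset.range (N + 1), if n ≤ m + k then
    PowerSeries.coeff (m + k - n) (taylorAtZero (p k)) * (n.descFactorial k : ℂ) else 0

lemma diffCoeff_eq_zero {N : ℕ} {p : ℕ → ℂ → ℂ} {m n : ℕ} (h : m + N < n) :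
    diffCoeff N p m n = 0 := by
  refine Finset.sum_eq_zero fun k hk => if_neg ?_
  have := Finset.mem_range.1 hk
  omega

/-- Only degrees `n ≤ m + N` reach degree `m`, so the identity is a finite one for every formal
power series, without convergence. The cut-off `K` is left free so that it can be enlarged to
contain a given index. -/
lemma coeff_diffExpr (N : ℕ) (p : ℕ → ℂ → ℂ) (f : ℂ⟦X⟧) {m K : ℕ} (hK : m + N + 1 ≤ K) :
    PowerSeries.coeff m (diffExpr N p f) =
      ∑ n ∈ Finset.range K, diffCoeff N p m n * PowerSeries.coeff n f := by
  simp only [diffExpr, LinearMap.sum_apply, map_sum, LinearMap.comp_apply, LinearMap.mulLeft_apply,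
    diffCoeff, Finset.sum_mul]
  rw [Finset.sum_comm]
  refine Finset.sum_congr rfl fun k hk => ?_
  have hk' := Finset.mem_range.1 hk
  have e : ((PowerSeries.derivative ℂ : ℂ⟦X⟧ →ₗ[ℂ] ℂ⟦X⟧) ^ k) f =
      (PowerSeries.derivative ℂ)^[k] f := by
    rw [Module.End.pow_apply]; rfl
  rw [e, PowerSeries.coeff_mul, Finset.Nat.sum_antidiagonal_eq_sum_range_succ_mk]
  simp_rw [PowerSeries.coeff_iterate_derivative]
  rw [← Finset.sum_range_reflect]
  symm
  have hsub : (Finset.range (m + 1)).map (addRightEmbedding k) ⊆ Finset.range K := by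
    intro n hn
    simp only [Finset.mem_map, Finset.mem_range, addRightEmbedding_apply] at hn ⊢
    omega
  rw [← Finset.sum_subset hsub, Finset.sum_map]
  · refine Finset.sum_congr rfl fun l hl => ?_
    have hl' := Finset.mem_range.1 hl
    rw [addRightEmbedding_apply, if_pos (by omega)]
    have e1 : m + 1 - 1 - l = m - l := by omega
    have e2 : m - (m - l) = l := by omega
    have e3 : m + k - (l + k) = m - l := by omega
    rw [e1, e2, e3, Nat.add_descFactorial_eq_ascFactorial, mul_assoc]
  · intro n hn hn'
    simp only [Finset.mem_map, Finset.mem_range, addRightEmbedding_apply, not_exists, not_and]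
      at hn hn'
    by_cases h1 : n < k
    · rw [Nat.descFactorial_of_lt h1]; simp
    · have := hn' (n - k)
      rw [if_neg (by omega), zero_mul]

lemma coeff_diffExpr_X_pow (N : ℕ) (p : ℕ → ℂ → ℂ) (m n : ℕ) :
    PowerSeries.coeff m (diffExpr N p (PowerSeries.X ^ n)) = diffCoeff N p m n := by
  rw [coeff_diffExpr N p _ (le_max_left (m + N + 1) (n + 1)), Finset.sum_eq_single n]
  · simp
  · intro i _ hi
    rw [PowerSeries.coeff_X_pow, if_neg hi, mul_zero]
  · intro h
    exact absurd (Finset.mem_range.2 (by omega)) h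

/-- For a fixed column the coefficients decay geometrically. This puts `L z ^ n` in `H_β`, since the
weights grow at most polynomially. -/
lemma exists_norm_diffCoeff_le {N : ℕ} {p : ℕ → ℂ → ℂ} (hreg : DiskRegular N p) (n : ℕ) :
    ∃ C r : ℝ, 0 ≤ C ∧ 0 < r ∧ r < 1 ∧ ∀ m, ‖diffCoeff N p m n‖ ≤ C * r ^ m := by
  have h1 : ∀ k : Fin (N + 1), ∃ C r : ℝ, 0 ≤ C ∧ 0 < r ∧ r < 1 ∧
      ∀ i, ‖PowerSeries.coeff i (taylorAtZero (p k))‖ ≤ C * r ^ i := fun k =>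
    exists_norm_coeff_taylorAtZero_le (hreg.1 k (Nat.lt_succ_iff.1 k.2))
  choose C r hC hr hr1 hb using h1
  set R := Finset.univ.sup' Finset.univ_nonempty r with hR
  have hRle : ∀ k, r k ≤ R := fun k => Finset.le_sup' r (Finset.mem_univ k)
  have hR0 : 0 < R := (hr 0).trans_le (hRle 0)
  have hR1 : R < 1 := (Finset.sup'_lt_iff _).2 fun k _ => hr1 k
  refine ⟨∑ k : Fin (N + 1), C k * R⁻¹ ^ n * (n.descFactorial k : ℝ), R,
    Finset.sum_nonneg fun k _ => by have := hC k; positivity, hR0, hR1, fun m => ?_⟩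
  rw [diffCoeff, Finset.sum_range, Finset.sum_mul]
  refine norm_sum_le_of_le _ fun k _ => ?_
  have hCk := hC k
  split_ifs with h
  · rw [norm_mul, Complex.norm_natCast]
    have h2 : R ^ (m + k - n) ≤ R⁻¹ ^ n * R ^ m := by
      rw [inv_pow, inv_mul_eq_div, le_div_iff₀ (by positivity), ← pow_add]
      exact pow_le_pow_of_le_one hR0.le hR1.le (by omega)
    calc _ ≤ C k * R ^ (m + k - n) * (n.descFactorial k : ℝ) := by
          refine mul_le_mul_of_nonneg_right ((hb k _).trans ?_) (by positivity)
          exact mul_le_mul_of_nonneg_left (pow_le_pow_left₀ (hr k).le (hRle k) _) hCk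
      _ ≤ C k * (R⁻¹ ^ n * R ^ m) * (n.descFactorial k : ℝ) := by gcongr
      _ = _ := by ring
  · rw [norm_zero]; positivity

lemma abs_descFactorial_sub_le (n k : ℕ) :
    |(n.descFactorial k : ℝ) - ((n : ℝ) + 1) ^ k| ≤ (k * k : ℝ) * (((n : ℝ) + 1) ^ k / ((n : ℝ) + 1)) := by
  have hx : (0 : ℝ) < (n : ℝ) + 1 := by positivity
  induction k with
  | zero => simp
  | succ k ih =>
    have h1 : (n.descFactorial k : ℝ) ≤ ((n : ℝ) + 1) ^ k := by
      have : (n.descFactorial k : ℝ) ≤ (n : ℝ) ^ k := by exact_mod_cast n.descFactorial_le_pow k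
      exact this.trans (pow_le_pow_left₀ (by positivity) (by linarith) k)
    have h2 : |((n - k : ℕ) : ℝ) - ((n : ℝ) + 1)| ≤ k + 1 := by
      have ha : (n : ℝ) ≤ ((n - k : ℕ) : ℝ) + k := by exact_mod_cast (by omega : n ≤ n - k + k)
      have hb : ((n - k : ℕ) : ℝ) ≤ n := by exact_mod_cast (by omega : n - k ≤ n)
      rw [abs_le]; constructor <;> linarith [(Nat.cast_nonneg k : (0 : ℝ) ≤ k)]
    have e : ((n.descFactorial (k + 1) : ℕ) : ℝ) - ((n : ℝ) + 1) ^ (k + 1) =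
        (((n - k : ℕ) : ℝ) - ((n : ℝ) + 1)) * n.descFactorial k +
          ((n : ℝ) + 1) * ((n.descFactorial k : ℝ) - ((n : ℝ) + 1) ^ k) := by
      rw [Nat.descFactorial_succ]; push_cast; ring
    rw [e]
    refine (abs_add_le _ _).trans ?_
    rw [abs_mul, abs_mul, abs_of_pos hx, abs_of_nonneg (a := (n.descFactorial k : ℝ)) (Nat.cast_nonneg _)]
    calc _ ≤ ((k : ℝ) + 1) * ((n : ℝ) + 1) ^ k +
          ((n : ℝ) + 1) * ((k * k : ℝ) * (((n : ℝ) + 1) ^ k / ((n : ℝ) + 1))) := by gcongr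
      _ = ((k : ℝ) + 1 + k * k) * ((n : ℝ) + 1) ^ k := by field_simp
      -- The constant `k * k` closes the induction because `k + 1 + k ^ 2 ≤ (k + 1) ^ 2`.
      _ ≤ ((k + 1 : ℕ) * (k + 1 : ℕ) : ℝ) * ((n : ℝ) + 1) ^ k := by
          refine mul_le_mul_of_nonneg_right ?_ (by positivity)
          push_cast
          nlinarith [(Nat.cast_nonneg k : (0 : ℝ) ≤ k)]
      _ = _ := by rw [pow_succ]; field_simp

/-- Leading behaviour of the coefficients of `L z ^ n` along diagonals. -/
lemma exists_norm_diffCoeff_sub_le {N : ℕ} {p : ℕ → ℂ → ℂ} (hreg : DiskRegular N p) (W : ℕ) :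
    ∃ C : ℝ, 0 ≤ C ∧ ∀ m, ∀ n ∈ band W m, n ≤ m + N →
      ‖diffCoeff N p m n - PowerSeries.coeff (N + m - n) (taylorAtZero (p N)) * ((m : ℂ) + 1) ^ N‖
        ≤ C * (((m : ℝ) + 1) ^ N / ((m : ℝ) + 1)) := by
  have h1 : ∀ k : Fin (N + 1), ∃ C : ℝ, 0 ≤ C ∧
      ∀ i, ‖PowerSeries.coeff i (taylorAtZero (p k))‖ ≤ C := fun k => by
    obtain ⟨C, r, hC, hr, hr1, h⟩ :=
      exists_norm_coeff_taylorAtZero_le (hreg.1 k (Nat.lt_succ_iff.1 k.2))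
    exact ⟨C, hC, fun i => (h i).trans (mul_le_of_le_one_right hC (pow_le_one₀ hr.le hr1.le))⟩
  choose C hC hb using h1
  set CN := C (Fin.last N) with hCN
  have hbN : ∀ i, ‖PowerSeries.coeff i (taylorAtZero (p N))‖ ≤ CN := hb (Fin.last N)
  have hCN0 : 0 ≤ CN := hC _
  have hW0 : (0 : ℝ) ≤ W := Nat.cast_nonneg W
  set S := ∑ k : Fin N, C k.castSucc with hS
  have hS0 : 0 ≤ S := Finset.sum_nonneg fun k _ => hC _
  -- The first term replaces the falling factorial of `n` by `(n + 1) ^ N`, with the error moved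
  -- from `n` to `m`. The second replaces `(n + 1) ^ N` by `(m + 1) ^ N`.
  set D : ℝ := CN * (N * N * (W + 1) ^ N * (W + 1) + W * N * (W + 1) ^ N) with hD
  refine ⟨S * (W + 1) ^ N + D, by positivity, fun m n hn hnm => ?_⟩
  have hx : (0 : ℝ) < (m : ℝ) + 1 := by positivity
  have hxn : (0 : ℝ) < (n : ℝ) + 1 := by positivity
  have hnm1 : (n : ℝ) + 1 ≤ (W + 1) * ((m : ℝ) + 1) := succ_le_of_mem_band hn
  rw [diffCoeff, Finset.sum_range_succ, if_pos hnm, Nat.add_comm N m, add_sub_assoc, ← mul_sub,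
    Finset.sum_range, add_mul]
  have hone : (1 : ℝ) ≤ (m : ℝ) + 1 := by linarith [(Nat.cast_nonneg m : (0 : ℝ) ≤ m)]
  have hlow : ∀ k : Fin N, (n.descFactorial k : ℝ) ≤
      (W + 1) ^ N * (((m : ℝ) + 1) ^ N / ((m : ℝ) + 1)) := fun k => by
    have a1 : (n.descFactorial k : ℝ) ≤ (n : ℝ) ^ (k : ℕ) := by
      exact_mod_cast n.descFactorial_le_pow k
    have hk := k.2
    calc _ ≤ (n : ℝ) ^ (k : ℕ) := a1
      _ ≤ ((W + 1) * ((m : ℝ) + 1)) ^ (k : ℕ) :=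
          pow_le_pow_left₀ (by positivity) (by linarith) _
      _ = (W + 1) ^ (k : ℕ) * ((m : ℝ) + 1) ^ (k : ℕ) := mul_pow _ _ _
      _ ≤ (W + 1) ^ N * ((m : ℝ) + 1) ^ (N - 1) := by
          have b1 : ((W : ℝ) + 1) ^ (k : ℕ) ≤ (W + 1) ^ N :=
            pow_le_pow_right₀ (by linarith) hk.le
          have b2 : ((m : ℝ) + 1) ^ (k : ℕ) ≤ ((m : ℝ) + 1) ^ (N - 1) :=
            pow_le_pow_right₀ hone (by omega)
          gcongr
      _ = _ := by
          congr 1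
          rw [eq_div_iff hx.ne', ← pow_succ]
          congr 1
          omega
  refine (norm_add_le _ _).trans (add_le_add ?_ ?_)
  · rw [hS, mul_assoc, Finset.sum_mul]
    refine norm_sum_le_of_le _ fun k _ => ?_
    split_ifs with h
    · rw [norm_mul, Complex.norm_natCast]
      exact mul_le_mul (hb k.castSucc _) (hlow k) (by positivity) (hC _)
    · rw [norm_zero]
      have := hC k.castSucc
      positivity
  · have e1 := abs_descFactorial_sub_le n N
    have e2 := abs_damped_pow_sub_le (le_refl (0 : ℝ)) hn N
    rw [damped_zero, damped_zero] at e2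
    have e3 := succ_pow_div_le_of_mem_band hn N
    have e4 : ‖((n.descFactorial N : ℕ) : ℂ) - ((m : ℂ) + 1) ^ N‖ ≤
        (N * N * (W + 1) ^ N * (W + 1) + W * N * (W + 1) ^ N) *
          (((m : ℝ) + 1) ^ N / ((m : ℝ) + 1)) := by
      have c0 : ((n.descFactorial N : ℕ) : ℂ) - ((m : ℂ) + 1) ^ N =
          (((n.descFactorial N : ℝ) - ((m : ℝ) + 1) ^ N : ℝ) : ℂ) := by push_cast; rfl
      rw [c0, Complex.norm_real, Real.norm_eq_abs]
      calc _ ≤ |(n.descFactorial N : ℝ) - ((n : ℝ) + 1) ^ N| +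
            |((n : ℝ) + 1) ^ N - ((m : ℝ) + 1) ^ N| := abs_sub_le _ _ _
        _ ≤ N * N * ((W + 1) ^ N * (W + 1) * (((m : ℝ) + 1) ^ N / ((m : ℝ) + 1))) +
            W * N * (W + 1) ^ N * (((m : ℝ) + 1) ^ N / ((m : ℝ) + 1)) := by
            refine add_le_add (e1.trans ?_) e2
            gcongr
        _ = _ := by ring
    rw [norm_mul, hD, mul_assoc CN]
    exact mul_le_mul (hbN _) e4 (norm_nonneg _) hCN0

/-! ### Slow variation and growth of the weights -/

namespace WeightSeq

/-- The one-step bounds are iterated. Both normalisations are kept because a band reaches to either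
side of its centre, so the weight used as divisor may have the smaller or the larger index. -/
lemma exists_abs_sub_le {β : WeightSeq} {c : ℝ} (hc : 0 ≤ c)
    (h1 : ∀ n : ℕ, |β (n + 1) - β n| ≤ c * (β n / ((n : ℝ) + 1)))
    (h2 : ∀ n : ℕ, |β (n + 1) - β n| ≤ c * (β (n + 1) / ((n : ℝ) + 1))) (j : ℕ) :
    ∃ D : ℝ, 0 ≤ D ∧ ∀ i ≤ j, ∀ n : ℕ, |β (n + i) - β n| ≤ D * (β n / ((n : ℝ) + 1)) ∧
      |β (n + i) - β n| ≤ D * (β (n + i) / ((n : ℝ) + 1)) := by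
  induction j with
  | zero =>
    refine ⟨0, le_rfl, fun i hi n => ?_⟩
    obtain rfl : i = 0 := by omega
    simp
  | succ j ih =>
    obtain ⟨D, hD, H⟩ := ih
    refine ⟨c * (1 + D) + D * (1 + c), by positivity, fun i hi n => ?_⟩
    have hx : (1 : ℝ) ≤ (n : ℝ) + 1 := by linarith [(Nat.cast_nonneg n : (0 : ℝ) ≤ n)]
    have hbn := β.pos n
    have hbi := β.pos (n + i)
    rcases Nat.lt_or_ge j i with hj | hj
    · obtain rfl : i = j + 1 := by omega
      have hbj := β.pos (n + j)
      obtain ⟨a1, a2⟩ := H j le_rfl n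
      have b1 := h1 (n + j)
      have b2 := h2 (n + j)
      rw [show n + j + 1 = n + (j + 1) by omega] at b1 b2
      have hle : (n : ℝ) + 1 ≤ ((n + j : ℕ) : ℝ) + 1 := by
        push_cast; linarith [(Nat.cast_nonneg j : (0 : ℝ) ≤ j)]
      have e1 : β (n + j) ≤ (1 + D) * β n := by
        have : β n / ((n : ℝ) + 1) ≤ β n := div_le_self hbn.le hx
        have := (abs_le.1 a1).2
        nlinarith
      have e2 : β (n + j) ≤ (1 + c) * β (n + (j + 1)) := by
        have : β (n + (j + 1)) / (((n + j : ℕ) : ℝ) + 1) ≤ β (n + (j + 1)) :=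
          div_le_self hbi.le (by linarith)
        have := (abs_le.1 b2).1
        nlinarith
      have t := abs_sub_le (β (n + (j + 1))) (β (n + j)) (β n)
      constructor
      · calc _ ≤ c * (((1 + D) * β n) / ((n : ℝ) + 1)) + D * (β n / ((n : ℝ) + 1)) := by
              refine t.trans (add_le_add (b1.trans ?_) a1)
              gcongr
          _ ≤ c * (((1 + D) * β n) / ((n : ℝ) + 1)) + D * (1 + c) * (β n / ((n : ℝ) + 1)) := by
              gcongr
              nlinarith
          _ = _ := by ring
      · calc _ ≤ c * (β (n + (j + 1)) / ((n : ℝ) + 1)) +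
              D * ((1 + c) * β (n + (j + 1)) / ((n : ℝ) + 1)) := by
              refine t.trans (add_le_add (b2.trans ?_) (a2.trans ?_)) <;> gcongr
          _ ≤ c * (1 + D) * (β (n + (j + 1)) / ((n : ℝ) + 1)) +
              D * ((1 + c) * β (n + (j + 1)) / ((n : ℝ) + 1)) := by
              gcongr
              nlinarith
          _ = _ := by ring
    · obtain ⟨a1, a2⟩ := H i hj n
      have hDle : D ≤ c * (1 + D) + D * (1 + c) := by nlinarith [mul_nonneg hD hc]
      exact ⟨a1.trans (mul_le_mul_of_nonneg_right hDle (by positivity)),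
        a2.trans (mul_le_mul_of_nonneg_right hDle (by positivity))⟩

variable {σ : ℝ} {β : WeightSeq}

/-- The recursion gives `β (n + 1) ^ 2 - β n ^ 2` as `1 - σ` times `β n ^ 2 / (n + σ)`, and also
times `β (n + 1) ^ 2 / (n + 1)`. Dividing by `β (n + 1) + β n` yields the two bounds. -/
lemma abs_succ_sub_le (hσ : 0 < σ)
    (hβ : ∀ n : ℕ, β (n + 1) ^ 2 = β n ^ 2 * (((n : ℝ) + 1) / ((n : ℝ) + σ))) (n : ℕ) :
    |β (n + 1) - β n| ≤ |1 - σ| * (1 + 1 / σ) * (β n / ((n : ℝ) + 1)) ∧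
    |β (n + 1) - β n| ≤ |1 - σ| * (1 + 1 / σ) * (β (n + 1) / ((n : ℝ) + 1)) := by
  have hb := β.pos n
  have hb1 := β.pos (n + 1)
  have hn : (0 : ℝ) ≤ n := Nat.cast_nonneg n
  have hx : 0 < (n : ℝ) + 1 := by positivity
  have hy : 0 < (n : ℝ) + σ := by positivity
  have hs : 0 < β (n + 1) + β n := by positivity
  have e0 : |β (n + 1) - β n| * (β (n + 1) + β n) = |β (n + 1) ^ 2 - β n ^ 2| := by
    have : β (n + 1) ^ 2 - β n ^ 2 = (β (n + 1) - β n) * (β (n + 1) + β n) := by ring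
    rw [this, abs_mul, abs_of_pos hs]
  have e1 : β (n + 1) ^ 2 - β n ^ 2 = (1 - σ) * (β n ^ 2 / ((n : ℝ) + σ)) := by
    rw [hβ n]; field_simp; ring
  have e2 : β (n + 1) ^ 2 - β n ^ 2 = (1 - σ) * (β (n + 1) ^ 2 / ((n : ℝ) + 1)) := by
    rw [hβ n]; field_simp; ring
  have k1 : 1 / ((n : ℝ) + σ) ≤ (1 + 1 / σ) / ((n : ℝ) + 1) := by
    rw [div_le_div_iff₀ hy hx]
    have : (1 + 1 / σ) * ((n : ℝ) + σ) = n + 1 + σ + n / σ := by field_simp; ring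
    rw [this]
    have : 0 ≤ (n : ℝ) / σ := by positivity
    linarith
  have k2 : 0 ≤ |1 - σ| := abs_nonneg _
  constructor
  · refine le_of_mul_le_mul_right ?_ hs
    rw [e0, e1, abs_mul, abs_of_nonneg (a := β n ^ 2 / ((n : ℝ) + σ)) (by positivity)]
    calc |1 - σ| * (β n ^ 2 / ((n : ℝ) + σ)) = |1 - σ| * (β n * β n) * (1 / ((n : ℝ) + σ)) := by ring
      _ ≤ |1 - σ| * (β n * (β (n + 1) + β n)) * ((1 + 1 / σ) / ((n : ℝ) + 1)) := by
          gcongr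
          linarith
      _ = _ := by ring
  · refine le_of_mul_le_mul_right ?_ hs
    rw [e0, e2, abs_mul, abs_of_nonneg (a := β (n + 1) ^ 2 / ((n : ℝ) + 1)) (by positivity)]
    have k3 : (1 : ℝ) ≤ 1 + 1 / σ := by
      have : 0 < 1 / σ := by positivity
      linarith
    calc |1 - σ| * (β (n + 1) ^ 2 / ((n : ℝ) + 1)) =
          |1 - σ| * 1 * (β (n + 1) / ((n : ℝ) + 1)) * β (n + 1) := by ring
      _ ≤ |1 - σ| * (1 + 1 / σ) * (β (n + 1) / ((n : ℝ) + 1)) * (β (n + 1) + β n) := by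
          gcongr
          linarith

lemma exists_abs_ratio_sub_one_le (hσ : 0 < σ)
    (hβ : ∀ n : ℕ, β (n + 1) ^ 2 = β n ^ 2 * (((n : ℝ) + 1) / ((n : ℝ) + σ))) (W : ℕ) :
    ∃ D : ℝ, 0 ≤ D ∧ ∀ m, ∀ n ∈ band W m, |β m / β n - 1| ≤ D / ((m : ℝ) + 1) := by
  obtain ⟨D, hD, H⟩ := exists_abs_sub_le (β := β) (c := |1 - σ| * (1 + 1 / σ)) (by positivity)
    (fun n => (abs_succ_sub_le hσ hβ n).1) (fun n => (abs_succ_sub_le hσ hβ n).2) W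
  -- The factor `W + 1` turns a denominator `n + 1` into `m + 1` when `n ≤ m`.
  refine ⟨D * (W + 1), by positivity, fun m n hn => ?_⟩
  have hb := β.pos n
  have hW : (0 : ℝ) ≤ W := Nat.cast_nonneg W
  have e : β m / β n - 1 = (β m - β n) / β n := by field_simp
  rw [e, abs_div, abs_of_pos hb, div_le_iff₀ hb]
  have hmn : (m : ℝ) + 1 ≤ (W + 1) * ((n : ℝ) + 1) := succ_le_of_mem_band (mem_band_comm.1 hn)
  rw [mem_band] at hn
  rcases le_total n m with h | h
  · obtain ⟨i, rfl⟩ := Nat.exists_eq_add_of_le h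
    refine ((H i (by omega) n).1).trans ?_
    rw [mul_div_assoc, mul_assoc, div_mul_eq_mul_div]
    refine mul_le_mul_of_nonneg_left ?_ hD
    rw [div_le_div_iff₀ (by positivity) (by positivity)]
    nlinarith
  · obtain ⟨i, rfl⟩ := Nat.exists_eq_add_of_le h
    rw [abs_sub_comm]
    refine ((H i (by omega) m).2).trans ?_
    rw [mul_div_assoc, mul_assoc]
    refine mul_le_mul_of_nonneg_left ?_ hD
    rw [div_mul_eq_mul_div]
    gcongr
    nlinarith

lemma exists_sq_le (hσ : 0 < σ)
    (hβ : ∀ n : ℕ, β (n + 1) ^ 2 = β n ^ 2 * (((n : ℝ) + 1) / ((n : ℝ) + σ))) :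
    ∃ E : ℝ, 0 ≤ E ∧ ∀ n : ℕ, β n ^ 2 ≤ E * ((n : ℝ) + 1) := by
  -- The induction starts at `β 1`, because the step from `β 0` carries the factor `1 / σ`, which
  -- may be large. Later factors are at most `(n + 2) / (n + 1)`.
  have h : ∀ n : ℕ, β (n + 1) ^ 2 ≤ β 1 ^ 2 * ((n : ℝ) + 1) := fun n => by
    induction n with
    | zero => simp
    | succ n ih =>
      rw [hβ (n + 1)]
      push_cast
      have k : ((n : ℝ) + 1 + 1) / ((n : ℝ) + 1 + σ) ≤ ((n : ℝ) + 1 + 1) / ((n : ℝ) + 1) :=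
        div_le_div_of_nonneg_left (by positivity) (by positivity) (by linarith)
      calc _ ≤ β 1 ^ 2 * ((n : ℝ) + 1) * (((n : ℝ) + 1 + 1) / ((n : ℝ) + 1)) := by gcongr
        _ = _ := by field_simp
  refine ⟨β 0 ^ 2 + β 1 ^ 2, by positivity, fun n => ?_⟩
  rcases n with _ | n
  · have := sq_nonneg (β 1)
    simpa using this
  · refine (h n).trans ?_
    push_cast
    have := sq_nonneg (β 0)
    have := sq_nonneg (β 1)
    have : (0 : ℝ) ≤ n := Nat.cast_nonneg n
    nlinarith [mul_nonneg (sq_nonneg (β 0)) this]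

end WeightSeq

/-! ### Monomials, Hermitian symmetry and the band structure -/

namespace WeightedHardy

lemma polynomial_mem (β : WeightSeq) (q : Polynomial ℂ) : (q : ℂ⟦X⟧) ∈ WeightedHardy β := by
  change Summable _
  refine summable_of_ne_finset_zero (s := q.support) fun n hn => ?_
  rw [Polynomial.coeff_coe, Polynomial.notMem_support_iff.1 hn]
  simp

/-- The monomial `z ^ n`. -/
def monomial (β : WeightSeq) (n : ℕ) : WeightedHardy β :=
  ⟨PowerSeries.X ^ n, by simpa using polynomial_mem β (Polynomial.X ^ n)⟩

lemma monomial_mem_polynomials (β : WeightSeq) (n : ℕ) : monomial β n ∈ polynomials β :=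
  ⟨Polynomial.X ^ n, by simp [monomial]⟩

lemma inner_monomial_left {β : WeightSeq} (n : ℕ) (f : WeightedHardy β) :
    inner ℂ (monomial β n) f = PowerSeries.coeff n f.1 * (β n : ℂ) ^ 2 := by
  rw [inner_def, tsum_eq_single n]
  · simp [monomial]
  · intro m hm
    simp [monomial, PowerSeries.coeff_X_pow, hm]

lemma inner_monomial_right {β : WeightSeq} (n : ℕ) (f : WeightedHardy β) :
    inner ℂ f (monomial β n) = conj (PowerSeries.coeff n f.1) * (β n : ℂ) ^ 2 := by
  rw [← inner_conj_symm, inner_monomial_left]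
  simp

end WeightedHardy

open WeightedHardy

variable {σ : ℝ} {β : WeightSeq} {N : ℕ} {p : ℕ → ℂ → ℂ}

lemma diffExpr_X_pow_mem (hσ : 0 < σ)
    (hβ : ∀ n : ℕ, β (n + 1) ^ 2 = β n ^ 2 * (((n : ℝ) + 1) / ((n : ℝ) + σ)))
    (hreg : DiskRegular N p) (n : ℕ) : diffExpr N p (PowerSeries.X ^ n) ∈ WeightedHardy β := by
  change Summable _
  simp_rw [coeff_diffExpr_X_pow]
  obtain ⟨C, r, hC, hr, hr1, h⟩ := exists_norm_diffCoeff_le hreg n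
  obtain ⟨E, hE, hE'⟩ := WeightSeq.exists_sq_le hσ hβ
  have hr2 : ‖r ^ 2‖ < 1 := by
    rw [Real.norm_of_nonneg (by positivity)]
    exact pow_lt_one₀ hr.le hr1 (by norm_num)
  have hs := (summable_pow_mul_geometric_of_norm_lt_one 1 hr2).add
    (summable_geometric_of_norm_lt_one hr2)
  refine Summable.of_nonneg_of_le (fun m => by positivity) (fun m => ?_) (hs.mul_left (C ^ 2 * E))
  calc _ ≤ (C * r ^ m) ^ 2 * (E * ((m : ℝ) + 1)) := by
        gcongr
        · exact h m
        · exact hE' m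
    _ = _ := by ring

lemma monomial_mem_maxOp_domain (hσ : 0 < σ)
    (hβ : ∀ n : ℕ, β (n + 1) ^ 2 = β n ^ 2 * (((n : ℝ) + 1) / ((n : ℝ) + σ)))
    (hreg : DiskRegular N p) (n : ℕ) : monomial β n ∈ (maxOp β N p).domain :=
  diffExpr_X_pow_mem hσ hβ hreg n

lemma maxOp_apply_coe (f : (maxOp β N p).domain) :
    ((maxOp β N p f : WeightedHardy β) : ℂ⟦X⟧) = diffExpr N p f.1.1 := rfl

lemma minOp_apply_coe (f : (minOp β N p).domain) :
    ((minOp β N p f : WeightedHardy β) : ℂ⟦X⟧) = diffExpr N p f.1.1 := rfl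

/-- Symmetry on monomials. -/
lemma diffCoeff_symm (hσ : 0 < σ)
    (hβ : ∀ n : ℕ, β (n + 1) ^ 2 = β n ^ 2 * (((n : ℝ) + 1) / ((n : ℝ) + σ)))
    (hreg : DiskRegular N p) (hsymm : FormallySymmetric β N p) (m n : ℕ) :
    diffCoeff N p m n * (β m : ℂ) ^ 2 = conj (diffCoeff N p n m) * (β n : ℂ) ^ 2 := by
  have h := hsymm
    ⟨monomial β m, monomial_mem_polynomials β m, monomial_mem_maxOp_domain hσ hβ hreg m⟩
    ⟨monomial β n, monomial_mem_polynomials β n, monomial_mem_maxOp_domain hσ hβ hreg n⟩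
  rw [inner_monomial_right, inner_monomial_left, minOp_apply_coe, minOp_apply_coe] at h
  simp only [monomial, coeff_diffExpr_X_pow] at h
  exact h.symm

/-- The matrix of `L` in the orthonormal basis `z ^ n / β n`. -/
def diffMatrix (β : WeightSeq) (N : ℕ) (p : ℕ → ℂ → ℂ) (m n : ℕ) : ℂ :=
  diffCoeff N p m n * ((β m / β n : ℝ) : ℂ)

lemma diffMatrix_conj (hσ : 0 < σ)
    (hβ : ∀ n : ℕ, β (n + 1) ^ 2 = β n ^ 2 * (((n : ℝ) + 1) / ((n : ℝ) + σ)))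
    (hreg : DiskRegular N p) (hsymm : FormallySymmetric β N p) (m n : ℕ) :
    conj (diffMatrix β N p n m) = diffMatrix β N p m n := by
  have h := diffCoeff_symm hσ hβ hreg hsymm m n
  have h1 : (β m : ℂ) ≠ 0 := by exact_mod_cast (β.pos m).ne'
  have h2 : (β n : ℂ) ≠ 0 := by exact_mod_cast (β.pos n).ne'
  rw [diffMatrix, diffMatrix, map_mul, Complex.conj_ofReal]
  push_cast
  field_simp
  rw [← h, mul_comm]

/-- Above the band there is nothing because `L` lowers degrees by at most `N`. Symmetry reflects
this to the other side of the diagonal. -/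
lemma diffCoeff_eq_zero_of_notMem_band (hσ : 0 < σ)
    (hβ : ∀ n : ℕ, β (n + 1) ^ 2 = β n ^ 2 * (((n : ℝ) + 1) / ((n : ℝ) + σ)))
    (hreg : DiskRegular N p) (hsymm : FormallySymmetric β N p) {m n : ℕ} (h : n ∉ band N m) :
    diffCoeff N p m n = 0 := by
  rw [mem_band, not_and_or, not_le, not_le] at h
  rcases h with h | h
  · have h1 := diffCoeff_symm hσ hβ hreg hsymm m n
    rw [diffCoeff_eq_zero h, map_zero, zero_mul] at h1
    have h2 : (β m : ℂ) ^ 2 ≠ 0 := pow_ne_zero _ (by exact_mod_cast (β.pos m).ne')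
    exact (mul_eq_zero.1 h1).resolve_right h2
  · exact diffCoeff_eq_zero h

lemma coeff_diffExpr_mul_weight (hσ : 0 < σ)
    (hβ : ∀ n : ℕ, β (n + 1) ^ 2 = β n ^ 2 * (((n : ℝ) + 1) / ((n : ℝ) + σ)))
    (hreg : DiskRegular N p) (hsymm : FormallySymmetric β N p) (f : ℂ⟦X⟧) (m : ℕ) :
    PowerSeries.coeff m (diffExpr N p f) * (β m : ℂ) =
      ∑ n ∈ band N m, diffMatrix β N p m n * (PowerSeries.coeff n f * (β n : ℂ)) := by
  rw [coeff_diffExpr N p f le_rfl, Finset.sum_mul]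
  symm
  have hsub : band N m ⊆ Finset.range (m + N + 1) := fun n hn =>
    Finset.mem_range.2 (by have := (mem_band.1 hn).2; omega)
  have e : ∀ n, diffMatrix β N p m n * (PowerSeries.coeff n f * (β n : ℂ)) =
      diffCoeff N p m n * PowerSeries.coeff n f * (β m : ℂ) := fun n => by
    have h2 : (β n : ℂ) ≠ 0 := by exact_mod_cast (β.pos n).ne'
    rw [diffMatrix]
    push_cast
    field_simp
  simp_rw [e]
  refine Finset.sum_subset hsub fun n _ hn => ?_
  rw [diffCoeff_eq_zero_of_notMem_band hσ hβ hreg hsymm hn, zero_mul, zero_mul]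

/-! ### Leading coefficients and ellipticity of the symbol -/

/-- If a constant is dominated by `C / (m + 1)` for all large `m`, it vanishes. -/
lemma eq_zero_of_norm_mul_pow_le {c : ℂ} {C : ℝ} {k N : ℕ}
    (h : ∀ m : ℕ, k ≤ m → ‖c‖ * ((m : ℝ) + 1) ^ N ≤ C * (((m : ℝ) + 1) ^ N / ((m : ℝ) + 1))) :
    c = 0 := by
  have h1 : ∀ m : ℕ, k ≤ m → ‖c‖ ≤ C * (1 / ((m : ℝ) + 1)) := fun m hm => by
    have hx : (0 : ℝ) < ((m : ℝ) + 1) ^ N := by positivity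
    refine le_of_mul_le_mul_right ((h m hm).trans (le_of_eq ?_)) hx
    ring
  have h2 : ‖c‖ ≤ C * 0 := by
    refine ge_of_tendsto (tendsto_one_div_add_atTop_nhds_zero_nat.const_mul C) ?_
    filter_upwards [Filter.eventually_ge_atTop k] with m hm using h1 m hm
  rw [mul_zero] at h2
  exact norm_le_zero_iff.1 h2

/-- The Taylor coefficients of the leading coefficient `p N`. -/
abbrev leadingCoeffs (N : ℕ) (p : ℕ → ℂ → ℂ) (i : ℕ) : ℂ :=
  PowerSeries.coeff i (taylorAtZero (p N))

/-- Along the diagonal `n = m + N - i` the entries vanish, being outside the band, yet they equal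
`leadingCoeffs N p i * (m + 1) ^ N` up to order `N - 1`. This uses the asymptotics on bands wider
than `N`. -/
lemma leadingCoeffs_eq_zero (hσ : 0 < σ)
    (hβ : ∀ n : ℕ, β (n + 1) ^ 2 = β n ^ 2 * (((n : ℝ) + 1) / ((n : ℝ) + σ)))
    (hreg : DiskRegular N p) (hsymm : FormallySymmetric β N p) {i : ℕ} (hi : 2 * N + 1 ≤ i) :
    leadingCoeffs N p i = 0 := by
  obtain ⟨C, hC, H⟩ := exists_norm_diffCoeff_sub_le hreg i
  refine eq_zero_of_norm_mul_pow_le (C := C) (k := i) (N := N) fun m hm => ?_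
  have h := H m (m + N - i) (mem_band.2 (by omega)) (by omega)
  rw [diffCoeff_eq_zero_of_notMem_band hσ hβ hreg hsymm (by rw [mem_band]; omega), zero_sub,
    norm_neg, norm_mul, show N + m - (m + N - i) = i by omega] at h
  have e : ‖((m : ℂ) + 1) ^ N‖ = ((m : ℝ) + 1) ^ N := by
    rw [norm_pow]
    congr 1
    exact_mod_cast Complex.norm_natCast (m + 1)
  rwa [e] at h

lemma exists_norm_diffMatrix_sub_le (hσ : 0 < σ)
    (hβ : ∀ n : ℕ, β (n + 1) ^ 2 = β n ^ 2 * (((n : ℝ) + 1) / ((n : ℝ) + σ)))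
    (hreg : DiskRegular N p) :
    ∃ C : ℝ, 0 < C ∧ ∀ m, ∀ n ∈ band N m,
      ‖diffMatrix β N p m n - leadingCoeffs N p (N + m - n) * ((m : ℂ) + 1) ^ N‖
        ≤ C * (((m : ℝ) + 1) ^ N / ((m : ℝ) + 1)) := by
  obtain ⟨C, hC, H⟩ := exists_norm_diffCoeff_sub_le hreg N
  obtain ⟨D, hD, HD⟩ := WeightSeq.exists_abs_ratio_sub_one_le hσ hβ N
  obtain ⟨Q, r, hQ, hr, hr1, HQ⟩ := exists_norm_coeff_taylorAtZero_le (hreg.1 N le_rfl)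
  -- The summand `1` only makes the constant strictly positive, as the elliptic estimate requires.
  refine ⟨C * (1 + D) + Q * D + 1, by positivity, fun m n hn => ?_⟩
  have h1 := H m n hn (mem_band.1 hn).2
  have h2 := HD m n hn
  have hx : (0 : ℝ) < (m : ℝ) + 1 := by positivity
  have hq : ‖leadingCoeffs N p (N + m - n)‖ ≤ Q :=
    (HQ _).trans (mul_le_of_le_one_right hQ (pow_le_one₀ hr.le hr1.le))
  have hρ : |β m / β n| ≤ 1 + D := by
    have : D / ((m : ℝ) + 1) ≤ D := div_le_self hD (by linarith [(Nat.cast_nonneg m : (0:ℝ) ≤ m)])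
    have := abs_le.1 h2
    rw [abs_le]; constructor <;> linarith [div_pos (β.pos m) (β.pos n)]
  have hxc : ‖((m : ℂ) + 1) ^ N‖ = ((m : ℝ) + 1) ^ N := by
    rw [norm_pow]
    congr 1
    exact_mod_cast Complex.norm_natCast (m + 1)
  have e : diffMatrix β N p m n - leadingCoeffs N p (N + m - n) * ((m : ℂ) + 1) ^ N =
      (diffCoeff N p m n - leadingCoeffs N p (N + m - n) * ((m : ℂ) + 1) ^ N) *
        ((β m / β n : ℝ) : ℂ) +
      leadingCoeffs N p (N + m - n) * ((m : ℂ) + 1) ^ N * ((β m / β n - 1 : ℝ) : ℂ) := by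
    rw [diffMatrix]
    push_cast
    ring
  rw [e]
  refine (norm_add_le _ _).trans ?_
  rw [norm_mul, norm_mul, norm_mul, hxc, Complex.norm_real, Complex.norm_real, Real.norm_eq_abs,
    Real.norm_eq_abs]
  calc _ ≤ C * (((m : ℝ) + 1) ^ N / ((m : ℝ) + 1)) * (1 + D) +
        Q * ((m : ℝ) + 1) ^ N * (D / ((m : ℝ) + 1)) := by gcongr
    _ = (C * (1 + D) + Q * D) * (((m : ℝ) + 1) ^ N / ((m : ℝ) + 1)) := by ring
    _ ≤ _ := mul_le_mul_of_nonneg_right (by linarith) (by positivity)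

/-- The entries `(m, n)` and `(n, m)` with `n = m + i - N` are conjugate. Letting `m → ∞`, their
leading terms must be conjugate too. -/
lemma conj_leadingCoeffs (hσ : 0 < σ)
    (hβ : ∀ n : ℕ, β (n + 1) ^ 2 = β n ^ 2 * (((n : ℝ) + 1) / ((n : ℝ) + σ)))
    (hreg : DiskRegular N p) (hsymm : FormallySymmetric β N p) {i : ℕ} (hi : i ≤ 2 * N) :
    conj (leadingCoeffs N p i) = leadingCoeffs N p (2 * N - i) := by
  obtain ⟨C, hC, H⟩ := exists_norm_diffMatrix_sub_le hσ hβ hreg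
  set q := leadingCoeffs N p with hq
  rw [← sub_eq_zero]
  set c := conj (q i) - q (2 * N - i) with hc
  refine eq_zero_of_norm_mul_pow_le (C := C + C * ((N + 1) ^ N * (N + 1)) +
    ‖q i‖ * (N * N * (N + 1) ^ N)) (k := N) (N := N) fun m hm => ?_
  set n := m + i - N with hn
  have hb : n ∈ band N m := mem_band.2 (by omega)
  have h1 := H m n hb
  have h2 := H n m (mem_band_comm.1 hb)
  have h3 := abs_damped_pow_sub_le (le_refl (0 : ℝ)) hb N
  rw [show N + m - n = 2 * N - i by omega, ← diffMatrix_conj hσ hβ hreg hsymm] at h1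
  rw [show N + n - m = i by omega, ← RCLike.norm_conj] at h2
  rw [damped_zero, damped_zero] at h3
  have hxc : ‖((m : ℂ) + 1) ^ N‖ = ((m : ℝ) + 1) ^ N := by
    rw [norm_pow]
    congr 1
    exact_mod_cast Complex.norm_natCast (m + 1)
  have e : c * ((m : ℂ) + 1) ^ N =
      (conj (diffMatrix β N p n m) - q (2 * N - i) * ((m : ℂ) + 1) ^ N) -
        conj (diffMatrix β N p n m - q i * ((n : ℂ) + 1) ^ N) -
        conj (q i) * (((((n : ℝ) + 1) ^ N - ((m : ℝ) + 1) ^ N : ℝ)) : ℂ) := by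
    simp only [hc, map_sub, map_mul, map_pow, map_add, map_one, Complex.conj_natCast]
    push_cast
    ring
  have hcx : ‖c‖ * ((m : ℝ) + 1) ^ N = ‖c * ((m : ℂ) + 1) ^ N‖ := by rw [norm_mul, hxc]
  rw [hcx, e]
  refine (norm_sub_le _ _).trans ((add_le_add (norm_sub_le _ _) le_rfl).trans ?_)
  rw [norm_mul, RCLike.norm_conj (q i), Complex.norm_real, Real.norm_eq_abs]
  calc _ ≤ C * (((m : ℝ) + 1) ^ N / ((m : ℝ) + 1)) +
        C * ((N + 1) ^ N * (N + 1) * (((m : ℝ) + 1) ^ N / ((m : ℝ) + 1))) +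
        ‖q i‖ * (N * N * (N + 1) ^ N * (((m : ℝ) + 1) ^ N / ((m : ℝ) + 1))) := by
        refine add_le_add (add_le_add h1 (h2.trans ?_))
          (mul_le_mul_of_nonneg_left h3 (norm_nonneg _))
        exact mul_le_mul_of_nonneg_left (succ_pow_div_le_of_mem_band hb N) hC.le
    _ = _ := by ring

/-- This is where `p N` being a polynomial of degree at most `2 * N` on the closed disk is used. It
transfers the absence of zeros on the circle to the symbol. -/
lemma trigPoly_leadingCoeffs (hσ : 0 < σ)
    (hβ : ∀ n : ℕ, β (n + 1) ^ 2 = β n ^ 2 * (((n : ℝ) + 1) / ((n : ℝ) + σ)))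
    (hreg : DiskRegular N p) (hsymm : FormallySymmetric β N p) (t : ℝ) :
    trigPoly N (leadingCoeffs N p) t =
      Complex.exp (-(N : ℂ) * Complex.I * t) * p N (Complex.exp (Complex.I * t)) := by
  have hz : ‖Complex.exp (Complex.I * t)‖ = 1 := by
    rw [mul_comm]; exact Complex.norm_exp_ofReal_mul_I t
  rw [eq_sum_of_taylorAtZero_finite (hreg.1 N le_rfl)
    (fun i hi => leadingCoeffs_eq_zero hσ hβ hreg hsymm hi) hz.le, trigPoly, Finset.mul_sum]
  refine Finset.sum_congr rfl fun i _ => ?_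
  rw [← Complex.exp_nat_mul, mul_left_comm, ← Complex.exp_add]
  congr 2
  push_cast
  ring

lemma conj_trigPoly {q : ℕ → ℂ} (hq : ∀ i ≤ 2 * N, conj (q i) = q (2 * N - i)) (t : ℝ) :
    conj (trigPoly N q t) = trigPoly N q t := by
  rw [trigPoly, map_sum, ← Finset.sum_range_reflect]
  refine Finset.sum_congr rfl fun i hi => ?_
  have hi' := Finset.mem_range.1 hi
  rw [map_mul, hq _ (by omega), show 2 * N - (2 * N + 1 - 1 - i) = i by omega, ← Complex.exp_conj]
  congr 2
  have : ((2 * N + 1 - 1 - i : ℕ) : ℂ) = 2 * N - i := by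
    rw [show 2 * N + 1 - 1 - i = 2 * N - i by omega, Nat.cast_sub (by omega)]
    push_cast; rfl
  simp only [map_mul, Complex.conj_I, Complex.conj_ofReal, Int.cast_sub, Int.cast_natCast, map_sub,
    Complex.conj_natCast, map_ofNat, this]
  ring

lemma trigPoly_periodic (N : ℕ) (q : ℕ → ℂ) : Function.Periodic (trigPoly N q) (2 * Real.pi) := by
  intro t
  refine Finset.sum_congr rfl fun i _ => ?_
  congr 1
  have : (((i : ℤ) - N : ℤ) : ℂ) * Complex.I * ((t + 2 * Real.pi : ℝ) : ℂ) =
      (((i : ℤ) - N : ℤ) : ℂ) * Complex.I * t +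
        (((i : ℤ) - N : ℤ) : ℂ) * (2 * Real.pi * Complex.I) := by
    push_cast; ring
  rw [this, Complex.exp_add, Complex.exp_int_mul_two_pi_mul_I, mul_one]

lemma exists_pos_le_of_periodic {s : ℝ → ℝ} (hc : Continuous s)
    (hp : Function.Periodic s (2 * Real.pi))
    (h : ∀ t, 0 < s t) : ∃ δ : ℝ, 0 < δ ∧ ∀ t, δ ≤ s t := by
  have hpi : (0 : ℝ) < 2 * Real.pi := by positivity
  obtain ⟨t0, _, ht0⟩ := isCompact_Icc.exists_isMinOn (Set.nonempty_Icc.2 hpi.le) hc.continuousOn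
  refine ⟨s t0, h t0, fun t => ?_⟩
  obtain ⟨t', ht', e⟩ := hp.exists_mem_Ico₀ hpi t
  rw [e]
  exact ht0 (Set.Ico_subset_Icc_self ht')

/-- Ellipticity: up to a sign the symbol of `L` is bounded below by a positive constant. -/
lemma exists_symbol_lower_bound (hσ : 0 < σ)
    (hβ : ∀ n : ℕ, β (n + 1) ^ 2 = β n ^ 2 * (((n : ℝ) + 1) / ((n : ℝ) + σ)))
    (hreg : DiskRegular N p) (hsymm : FormallySymmetric β N p) :
    ∃ (θ : ℂ) (δ : ℝ), ‖θ‖ ≤ 1 ∧ 0 < δ ∧ ∀ t, δ ≤ (θ * trigPoly N (leadingCoeffs N p) t).re := by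
  set s := trigPoly N (leadingCoeffs N p) with hs
  have hne : ∀ t, s t ≠ 0 := fun t => by
    rw [hs, trigPoly_leadingCoeffs hσ hβ hreg hsymm]
    refine mul_ne_zero (Complex.exp_ne_zero _) (hreg.2 _ ?_)
    rw [mul_comm]; exact Complex.norm_exp_ofReal_mul_I t
  -- The symbol is real, so its real part cannot vanish either. The intermediate value theorem then
  -- fixes the sign, and `θ` is `1` or `-1` accordingly.
  have hre : ∀ t, (s t).re ≠ 0 := fun t h => by
    have h2 := conj_trigPoly (q := leadingCoeffs N p) (fun i hi => conj_leadingCoeffs hσ hβ hreg hsymm hi) t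
    exact hne t (Complex.ext h (Complex.conj_eq_iff_im.1 h2))
  have hcont : Continuous fun t => (s t).re :=
    Complex.continuous_re.comp (continuous_trigPoly _ _)
  have hper : Function.Periodic (fun t => (s t).re) (2 * Real.pi) := fun t => by
    simp only [hs, trigPoly_periodic N _ t]
  by_cases h0 : ∃ t, (s t).re ≤ 0
  · have hneg : ∀ t, 0 < -(s t).re := fun t => by
      by_contra hcon
      obtain ⟨t', ht'⟩ := mem_range_of_exists_le_of_exists_ge hcont h0 ⟨t, by linarith⟩
      exact hre t' ht'
    obtain ⟨δ, hδ, H⟩ := exists_pos_le_of_periodic hcont.neg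
      (fun t => by simpa using hper t) hneg
    exact ⟨-1, δ, by simp, hδ, fun t => by simpa using H t⟩
  · push Not at h0
    obtain ⟨δ, hδ, H⟩ := exists_pos_le_of_periodic hcont hper h0
    exact ⟨1, δ, by simp, hδ, fun t => by simpa using H t⟩

/-! ### Orthonormal coordinates, truncations and density of polynomials -/

namespace WeightedHardy

variable {β : WeightSeq}

/-- Coordinates in the orthonormal basis `z ^ n / β n`. -/
def coord (f : WeightedHardy β) (n : ℕ) : ℂ := PowerSeries.coeff n f.1 * (β n : ℂ)

lemma norm_coord_sq (f : WeightedHardy β) (n : ℕ) :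
    ‖coord f n‖ ^ 2 = ‖PowerSeries.coeff n f.1‖ ^ 2 * β n ^ 2 := by
  rw [coord, norm_mul, Complex.norm_real, mul_pow, Real.norm_eq_abs, sq_abs]

lemma summable_coord (f : WeightedHardy β) : Summable fun n => ‖coord f n‖ ^ 2 := by
  simp_rw [norm_coord_sq]
  exact f.2

lemma norm_sq_eq_coord (f : WeightedHardy β) : ‖f‖ ^ 2 = ∑' n, ‖coord f n‖ ^ 2 := by
  simp_rw [norm_coord_sq]
  exact norm_sq_eq f

lemma inner_eq_coord (g f : WeightedHardy β) :
    inner ℂ g f = ∑' n, conj (coord g n) * coord f n := by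
  rw [inner_def]
  refine tsum_congr fun n => ?_
  simp only [coord, map_mul, Complex.conj_ofReal]
  ring

lemma coord_sub (f g : WeightedHardy β) (n : ℕ) : coord (f - g) n = coord f n - coord g n := by
  simp [coord, sub_mul]

/-- Truncation of a power series to its terms of degree less than `K`. -/
def truncation (β : WeightSeq) (K : ℕ) : WeightedHardy β →L[ℂ] WeightedHardy β :=
  ∑ n ∈ Finset.range K, (ContinuousLinearMap.toSpanSingleton ℂ (monomial β n)).comp
    (((β n : ℂ) ^ 2)⁻¹ • innerSL ℂ (monomial β n))

lemma truncation_apply (K : ℕ) (f : WeightedHardy β) :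
    truncation β K f = ∑ n ∈ Finset.range K, PowerSeries.coeff n f.1 • monomial β n := by
  rw [truncation, sum_apply]
  refine Finset.sum_congr rfl fun n _ => ?_
  have h : (β n : ℂ) ≠ 0 := by exact_mod_cast (β.pos n).ne'
  simp only [ContinuousLinearMap.comp_apply, ContinuousLinearMap.toSpanSingleton_apply,
    smul_apply, innerSL_apply_apply, inner_monomial_left, smul_eq_mul]
  congr 1
  field_simp

lemma coord_truncation (K : ℕ) (f : WeightedHardy β) (n : ℕ) :
    coord (truncation β K f) n = if n < K then coord f n else 0 := by
  have h : PowerSeries.coeff n (truncation β K f).1 =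
      if n < K then PowerSeries.coeff n f.1 else 0 := by
    rw [truncation_apply]
    simp [monomial, PowerSeries.coeff_X_pow]
  rw [coord, h]
  split_ifs <;> simp [coord]

lemma truncation_mem_polynomials (K : ℕ) (f : WeightedHardy β) :
    truncation β K f ∈ polynomials β := by
  rw [truncation_apply]
  exact Submodule.sum_mem _ fun n _ =>
    Submodule.smul_mem _ _ (monomial_mem_polynomials β n)

lemma isCompactOperator_truncation (β : WeightSeq) (K : ℕ) :
    IsCompactOperator (truncation β K) := by
  unfold truncation
  refine Submodule.sum_mem (compactOperator (RingHom.id ℂ) (WeightedHardy β) (WeightedHardy β))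
    fun n _ => ?_
  exact (isCompactOperator_of_locallyCompactSpace_rng
    (ContinuousLinearMap.toSpanSingleton ℂ (monomial β n))).comp_clm _

lemma polynomials_dense (β : WeightSeq) : Dense (polynomials β : Set (WeightedHardy β)) := by
  rw [Submodule.dense_iff_topologicalClosure_eq_top, Submodule.topologicalClosure_eq_top_iff,
    Submodule.eq_bot_iff]
  intro f hf
  refine Subtype.ext (PowerSeries.ext fun n => ?_)
  have h := (Submodule.mem_orthogonal _ _).1 hf _ (monomial_mem_polynomials β n)
  rw [inner_monomial_left] at h
  have h2 : (β n : ℂ) ^ 2 ≠ 0 := pow_ne_zero _ (by exact_mod_cast (β.pos n).ne')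
  simpa using (mul_eq_zero.1 h).resolve_right h2

end WeightedHardy

lemma polynomials_le_maxOp_domain (hσ : 0 < σ)
    (hβ : ∀ n : ℕ, β (n + 1) ^ 2 = β n ^ 2 * (((n : ℝ) + 1) / ((n : ℝ) + σ)))
    (hreg : DiskRegular N p) : polynomials β ≤ (maxOp β N p).domain := by
  rintro f ⟨q, hq⟩
  have h : ∀ q : Polynomial ℂ, diffExpr N p (q : ℂ⟦X⟧) ∈ WeightedHardy β := fun q => by
    induction q using Polynomial.induction_on' with
    | add q r hq hr =>
      rw [Polynomial.coe_add, map_add]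
      exact Submodule.add_mem _ hq hr
    | monomial n a =>
      have : ((Polynomial.monomial n a : Polynomial ℂ) : ℂ⟦X⟧) = a • PowerSeries.X ^ n := by
        rw [Polynomial.coe_monomial, PowerSeries.X_pow_eq, ← map_smul, smul_eq_mul, mul_one]
      rw [this, map_smul]
      exact Submodule.smul_mem _ _ (diffExpr_X_pow_mem hσ hβ hreg n)
  change diffExpr N p f.1 ∈ WeightedHardy β
  rw [← hq]
  exact h q

lemma minOp_domain (hσ : 0 < σ)
    (hβ : ∀ n : ℕ, β (n + 1) ^ 2 = β n ^ 2 * (((n : ℝ) + 1) / ((n : ℝ) + σ)))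
    (hreg : DiskRegular N p) : (minOp β N p).domain = polynomials β :=
  inf_eq_left.2 (polynomials_le_maxOp_domain hσ hβ hreg)

lemma maxOp_domain_dense (hσ : 0 < σ)
    (hβ : ∀ n : ℕ, β (n + 1) ^ 2 = β n ^ 2 * (((n : ℝ) + 1) / ((n : ℝ) + σ)))
    (hreg : DiskRegular N p) : Dense ((maxOp β N p).domain : Set (WeightedHardy β)) :=
  (polynomials_dense β).mono (polynomials_le_maxOp_domain hσ hβ hreg)

lemma coord_maxOp (hσ : 0 < σ)
    (hβ : ∀ n : ℕ, β (n + 1) ^ 2 = β n ^ 2 * (((n : ℝ) + 1) / ((n : ℝ) + σ)))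
    (hreg : DiskRegular N p) (hsymm : FormallySymmetric β N p) (f : (maxOp β N p).domain) (m : ℕ) :
    coord (maxOp β N p f) m = ∑ n ∈ band N m, diffMatrix β N p m n * coord f.1 n :=
  coeff_diffExpr_mul_weight hσ hβ hreg hsymm f.1.1 m

/-! ### Regularity, self-adjointness and closure -/

/-- Regularity of the maximal domain, with the corresponding estimate. -/
theorem maxOp_regularity (hσ : 0 < σ)
    (hβ : ∀ n : ℕ, β (n + 1) ^ 2 = β n ^ 2 * (((n : ℝ) + 1) / ((n : ℝ) + σ)))
    (hreg : DiskRegular N p) (hsymm : FormallySymmetric β N p) :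
    ∃ K : ℝ, 0 ≤ K ∧ ∀ f : (maxOp β N p).domain,
      (Summable fun n : ℕ => (((n : ℝ) + 1) ^ N * ‖coord f.1 n‖) ^ 2) ∧
      ∑' n : ℕ, (((n : ℝ) + 1) ^ N * ‖coord f.1 n‖) ^ 2 ≤
        K * (‖maxOp β N p f‖ ^ 2 + ‖(f : WeightedHardy β)‖ ^ 2) := by
  obtain ⟨C, hC, hA⟩ := exists_norm_diffMatrix_sub_le hσ hβ hreg
  obtain ⟨θ, δ, hθ, hδ, hs⟩ := exists_symbol_lower_bound hσ hβ hreg hsymm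
  obtain ⟨Q, r, hQ, hr, hr1, HQ⟩ := exists_norm_coeff_taylorAtZero_le (hreg.1 N le_rfl)
  have hq : ∀ i, ‖leadingCoeffs N p i‖ ≤ Q := fun i =>
    (HQ _).trans (mul_le_of_le_one_right hQ (pow_le_one₀ hr.le hr1.le))
  obtain ⟨K, hK, H⟩ := elliptic_regularity (A := diffMatrix β N p)
    (a := fun m n => leadingCoeffs N p (N + m - n)) hC hδ hθ hA (fun m n => hq _)
    fun u hu => toeplitz_lower_bound hq hs hu
  refine ⟨K, hK, fun f => ?_⟩
  -- Membership of `L f` in `H_β` is exactly square-summability of the banded matrix applied to the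
  -- coordinates of `f`.
  have hg := summable_coord (maxOp β N p f)
  simp_rw [coord_maxOp hσ hβ hreg hsymm f] at hg
  have h := H (coord f.1) (summable_coord f.1) hg
  simp_rw [← coord_maxOp hσ hβ hreg hsymm f] at h
  rwa [← norm_sq_eq_coord, ← norm_sq_eq_coord] at h

lemma exists_norm_diffMatrix_le (hσ : 0 < σ)
    (hβ : ∀ n : ℕ, β (n + 1) ^ 2 = β n ^ 2 * (((n : ℝ) + 1) / ((n : ℝ) + σ)))
    (hreg : DiskRegular N p) :
    ∃ C : ℝ, 0 ≤ C ∧ ∀ m, ∀ n ∈ band N m,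
      ‖diffMatrix β N p m n‖ ≤ C * ((m : ℝ) + 1) ^ N := by
  obtain ⟨C, hC, hA⟩ := exists_norm_diffMatrix_sub_le hσ hβ hreg
  obtain ⟨Q, r, hQ, hr, hr1, HQ⟩ := exists_norm_coeff_taylorAtZero_le (hreg.1 N le_rfl)
  refine ⟨C + Q, by positivity, fun m n hn => ?_⟩
  have hq : ‖leadingCoeffs N p (N + m - n)‖ ≤ Q :=
    (HQ _).trans (mul_le_of_le_one_right hQ (pow_le_one₀ hr.le hr1.le))
  have hxc : ‖((m : ℂ) + 1) ^ N‖ = ((m : ℝ) + 1) ^ N := by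
    rw [norm_pow]
    congr 1
    exact_mod_cast Complex.norm_natCast (m + 1)
  have hx : ((m : ℝ) + 1) ^ N / ((m : ℝ) + 1) ≤ ((m : ℝ) + 1) ^ N :=
    div_le_self (by positivity) (by linarith [(Nat.cast_nonneg m : (0 : ℝ) ≤ m)])
  have h1 := norm_le_norm_sub_add (diffMatrix β N p m n)
    (leadingCoeffs N p (N + m - n) * ((m : ℂ) + 1) ^ N)
  rw [norm_mul, hxc] at h1
  refine h1.trans ?_
  rw [add_mul]
  refine add_le_add ((hA m n hn).trans ?_) ?_
  · gcongr
  · gcongr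

/-- The maximal operator is bounded with respect to the Sobolev-type norm of order `N`. -/
lemma exists_norm_maxOp_sq_le (hσ : 0 < σ)
    (hβ : ∀ n : ℕ, β (n + 1) ^ 2 = β n ^ 2 * (((n : ℝ) + 1) / ((n : ℝ) + σ)))
    (hreg : DiskRegular N p) (hsymm : FormallySymmetric β N p) :
    ∃ C : ℝ, 0 ≤ C ∧ ∀ f : (maxOp β N p).domain,
      ‖maxOp β N p f‖ ^ 2 ≤ C * ∑' n : ℕ, (((n : ℝ) + 1) ^ N * ‖coord f.1 n‖) ^ 2 := by
  obtain ⟨C, hC, hA⟩ := exists_norm_diffMatrix_le hσ hβ hreg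
  obtain ⟨K, hK, hreg'⟩ := maxOp_regularity hσ hβ hreg hsymm
  set E : ℝ := (2 * N + 1) * (C * (N + 1) ^ N) ^ 2 with hE
  have hE0 : 0 ≤ E := by positivity
  refine ⟨E * (2 * N + 1), by positivity, fun f => ?_⟩
  have hs := (hreg' f).1
  have h0 : ∀ n : ℕ, 0 ≤ (((n : ℝ) + 1) ^ N * ‖coord f.1 n‖) ^ 2 := fun n => by positivity
  have hb := summable_band N h0 hs
  rw [norm_sq_eq_coord, mul_assoc]
  refine le_trans ?_ (mul_le_mul_of_nonneg_left (tsum_band_le N h0 hs) hE0)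
  rw [← tsum_mul_left]
  refine (summable_coord _).tsum_le_tsum (fun m => ?_) (hb.mul_left E)
  rw [coord_maxOp hσ hβ hreg hsymm]
  have h1 : ‖∑ n ∈ band N m, diffMatrix β N p m n * coord f.1 n‖ ≤
      ∑ n ∈ band N m, C * (N + 1) ^ N * (((n : ℝ) + 1) ^ N * ‖coord f.1 n‖) := by
    refine norm_sum_le_of_le _ fun n hn => ?_
    have hx : ((m : ℝ) + 1) ^ N ≤ (N + 1) ^ N * ((n : ℝ) + 1) ^ N := by
      rw [← mul_pow]
      exact pow_le_pow_left₀ (by positivity) (succ_le_of_mem_band (mem_band_comm.1 hn)) N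
    rw [norm_mul]
    calc _ ≤ C * ((N + 1) ^ N * ((n : ℝ) + 1) ^ N) * ‖coord f.1 n‖ := by
          gcongr
          exact (hA m n hn).trans (by gcongr)
      _ = _ := by ring
  -- Cauchy–Schwarz over the at most `2 * N + 1` indices of a band.
  calc _ ≤ (∑ n ∈ band N m, C * (N + 1) ^ N * (((n : ℝ) + 1) ^ N * ‖coord f.1 n‖)) ^ 2 := by
        gcongr
    _ ≤ (band N m).card *
        ∑ n ∈ band N m, (C * (N + 1) ^ N * (((n : ℝ) + 1) ^ N * ‖coord f.1 n‖)) ^ 2 :=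
        sq_sum_le_card_mul_sum_sq
    _ ≤ (2 * N + 1) *
        ∑ n ∈ band N m, (C * (N + 1) ^ N * (((n : ℝ) + 1) ^ N * ‖coord f.1 n‖)) ^ 2 := by
        refine mul_le_mul_of_nonneg_right ?_ (Finset.sum_nonneg fun _ _ => sq_nonneg _)
        exact_mod_cast card_band_le N m
    _ = _ := by
        simp_rw [mul_pow _ (((_ : ℝ) + 1) ^ N * ‖coord f.1 _‖)]
        rw [← Finset.mul_sum, hE]
        ring

/-- Entries grow like `(m + 1) ^ N`, and regularity of `g` absorbs this growth. The double series is
then absolutely convergent, so the order of summation can be exchanged and the Hermitian symmetry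
applied. -/
theorem maxOp_isFormalAdjoint (hσ : 0 < σ)
    (hβ : ∀ n : ℕ, β (n + 1) ^ 2 = β n ^ 2 * (((n : ℝ) + 1) / ((n : ℝ) + σ)))
    (hreg : DiskRegular N p) (hsymm : FormallySymmetric β N p) :
    (maxOp β N p).IsFormalAdjoint (maxOp β N p) := by
  intro f g
  obtain ⟨C, hC, hA⟩ := exists_norm_diffMatrix_le hσ hβ hreg
  obtain ⟨K, hK, hreg'⟩ := maxOp_regularity hσ hβ hreg hsymm
  set A := diffMatrix β N p with hAdef
  have hs : Summable fun m => ∑ n ∈ band N m,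
      ‖conj (A m n) * conj (coord f.1 n) * coord g.1 m‖ := by
    have hw : Summable fun n : ℕ => ‖((((n : ℝ) + 1) ^ N : ℝ) : ℂ) * coord g.1 n‖ ^ 2 := by
      refine (hreg' g).1.congr fun n => ?_
      rw [norm_mul, Complex.norm_real, Real.norm_of_nonneg (by positivity)]
    have h := summable_band_mul (N := N) (a := fun m n => A m n / ((((m : ℝ) + 1) ^ N : ℝ) : ℂ))
      (C := C) (fun m n hn => by
        rw [norm_div, Complex.norm_real, Real.norm_of_nonneg (by positivity),
          div_le_iff₀ (by positivity)]
        exact hA m n hn) (summable_coord f.1) hw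
    refine h.congr fun m => Finset.sum_congr rfl fun n _ => ?_
    have hx : (0 : ℝ) < ((m : ℝ) + 1) ^ N := by positivity
    simp only [norm_mul, norm_div, RCLike.norm_conj, Complex.norm_real, Real.norm_of_nonneg hx.le]
    field_simp
  have h1 := tsum_band_comm N hs
  rw [inner_eq_coord, inner_eq_coord]
  convert h1 using 1
  · refine tsum_congr fun m => ?_
    rw [coord_maxOp hσ hβ hreg hsymm, map_sum, Finset.sum_mul]
    simp only [map_mul, hAdef]
  · refine tsum_congr fun n => ?_
    rw [coord_maxOp hσ hβ hreg hsymm, Finset.mul_sum]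
    refine Finset.sum_congr rfl fun m _ => ?_
    rw [diffMatrix_conj hσ hβ hreg hsymm]
    ring

/-- Symmetry gives one inclusion. For the other, pairing the adjoint with monomials computes its
Taylor coefficients and shows that it acts as `L`, so its domain lies in the maximal one. -/
theorem maxOp_isSelfAdjoint (hσ : 0 < σ)
    (hβ : ∀ n : ℕ, β (n + 1) ^ 2 = β n ^ 2 * (((n : ℝ) + 1) / ((n : ℝ) + σ)))
    (hreg : DiskRegular N p) (hsymm : FormallySymmetric β N p) :
    IsSelfAdjoint (maxOp β N p) := by
  have hd := maxOp_domain_dense hσ hβ hreg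
  have h1 := (maxOp_isFormalAdjoint hσ hβ hreg hsymm).le_adjoint hd
  rw [LinearPMap.isSelfAdjoint_def]
  refine le_antisymm ?_ h1
  have key : ∀ y : (maxOp β N p).adjoint.domain,
      diffExpr N p y.1.1 = ((maxOp β N p).adjoint y : WeightedHardy β).1 := fun y => by
    refine PowerSeries.ext fun n => ?_
    have h := LinearPMap.adjoint_isFormalAdjoint hd y
      ⟨monomial β n, monomial_mem_maxOp_domain hσ hβ hreg n⟩
    rw [inner_monomial_right, inner_def] at h
    have hb : (β n : ℂ) ^ 2 ≠ 0 := pow_ne_zero _ (by exact_mod_cast (β.pos n).ne')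
    have e : ∀ m, conj (PowerSeries.coeff m y.1.1) *
        PowerSeries.coeff m (maxOp β N p ⟨monomial β n, monomial_mem_maxOp_domain hσ hβ hreg n⟩).1 *
          (β m : ℂ) ^ 2 =
        conj (diffCoeff N p n m * PowerSeries.coeff m y.1.1) * (β n : ℂ) ^ 2 := fun m => by
      rw [maxOp_apply_coe]
      simp only [monomial, coeff_diffExpr_X_pow]
      rw [mul_assoc, diffCoeff_symm hσ hβ hreg hsymm, map_mul]
      ring
    simp_rw [e] at h
    -- Row `n` has no entries beyond column `n + N`, so the inner product is the finite sum defining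
    -- the coefficient of `L y`.
    rw [tsum_mul_right, tsum_eq_sum (s := Finset.range (n + N + 1)) (fun m hm => by
      rw [diffCoeff_eq_zero (by simpa using hm), zero_mul, map_zero])] at h
    have h2 := mul_right_cancel₀ hb h
    rw [← map_sum] at h2
    rw [coeff_diffExpr N p _ le_rfl]
    exact ((starRingEnd ℂ).injective h2).symm
  refine ⟨fun y hy => ?_, fun y z hyz => Subtype.ext ?_⟩
  · change diffExpr N p y.1 ∈ WeightedHardy β
    rw [key ⟨y, hy⟩]
    exact Subtype.prop _
  · rw [maxOp_apply_coe, ← key y, hyz]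

lemma minOp_le_maxOp : minOp β N p ≤ maxOp β N p := LinearPMap.domRestrict_le

/-- Self-adjointness makes `maxOp` closed. By regularity the truncations of `f` converge in the
weighted norm of order `N`, in which `L` is bounded, and so they converge in the graph norm. -/
theorem minOp_closure_eq (hσ : 0 < σ)
    (hβ : ∀ n : ℕ, β (n + 1) ^ 2 = β n ^ 2 * (((n : ℝ) + 1) / ((n : ℝ) + σ)))
    (hreg : DiskRegular N p) (hsymm : FormallySymmetric β N p) :
    (minOp β N p).IsClosable ∧ (minOp β N p).closure = maxOp β N p := by
  have hclosed := (maxOp_isSelfAdjoint hσ hβ hreg hsymm).isClosed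
  have hcl : (minOp β N p).IsClosable := hclosed.isClosable.leIsClosable minOp_le_maxOp
  refine ⟨hcl, LinearPMap.eq_of_eq_graph ?_⟩
  rw [← hcl.graph_closure_eq_closure_graph]
  refine le_antisymm (Submodule.topologicalClosure_minimal _
    (LinearPMap.le_graph_of_le minOp_le_maxOp) hclosed) ?_
  rintro ⟨f, g⟩ hfg
  obtain ⟨f, rfl, rfl⟩ := (LinearPMap.mem_graph_iff _).1 hfg
  obtain ⟨C, hC, hbd⟩ := exists_norm_maxOp_sq_le hσ hβ hreg hsymm
  obtain ⟨B, hB, hreg'⟩ := maxOp_regularity hσ hβ hreg hsymm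
  have hpd := polynomials_le_maxOp_domain hσ hβ hreg
  set φ : ℕ → (maxOp β N p).domain := fun K =>
    ⟨truncation β K f.1, hpd (truncation_mem_polynomials K f.1)⟩ with hφ
  set S : ℕ → ℝ := fun K => ∑' n : ℕ, (((n : ℝ) + 1) ^ N * ‖coord (f - φ K).1 n‖) ^ 2 with hS
  have hcoord : ∀ K n, coord (f - φ K).1 n = if n < K then 0 else coord f.1 n := fun K n => by
    change coord (f.1 - truncation β K f.1) n = _
    rw [coord_sub, coord_truncation]
    split_ifs <;> simp
  have hSlim : Filter.Tendsto S Filter.atTop (nhds 0) := by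
    have h0 : (0 : ℝ) = ∑' _n : ℕ, (0 : ℝ) := tsum_zero.symm
    rw [h0]
    refine tendsto_tsum_of_dominated_convergence (hreg' f).1 (fun n => ?_)
      (Filter.Eventually.of_forall fun K n => ?_)
    · refine tendsto_const_nhds.congr' ?_
      filter_upwards [Filter.eventually_gt_atTop n] with K hK
      rw [hcoord, if_pos hK]
      simp
    · rw [hcoord, Real.norm_of_nonneg (by positivity)]
      split_ifs
      · rw [norm_zero, mul_zero, zero_pow two_ne_zero]; positivity
      · exact le_rfl
  have hlim_of_sq : ∀ {u : ℕ → WeightedHardy β} {c : ℝ}, (∀ K, ‖u K‖ ^ 2 ≤ c * S K) →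
      Filter.Tendsto u Filter.atTop (nhds 0) := fun {u c} hu => by
    rw [tendsto_zero_iff_norm_tendsto_zero]
    have h2 : Filter.Tendsto (fun K => ‖u K‖ ^ 2) Filter.atTop (nhds 0) :=
      squeeze_zero (fun K => sq_nonneg _) hu (by simpa using hSlim.const_mul c)
    have h3 := (Real.continuous_sqrt.tendsto 0).comp h2
    simpa [Function.comp_def, Real.sqrt_sq (norm_nonneg _)] using h3
  have hl1 : Filter.Tendsto (fun K => ((f - φ K : (maxOp β N p).domain) : WeightedHardy β))
      Filter.atTop (nhds 0) := by
    refine hlim_of_sq (c := 1) fun K => ?_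
    rw [norm_sq_eq_coord, one_mul]
    refine (summable_coord _).tsum_le_tsum (fun n => ?_) (hreg' (f - φ K)).1
    have : (1 : ℝ) ≤ ((n : ℝ) + 1) ^ N := one_le_pow₀ (by linarith [(Nat.cast_nonneg n : (0 : ℝ) ≤ n)])
    exact pow_le_pow_left₀ (norm_nonneg _) (le_mul_of_one_le_left (norm_nonneg _) this) 2
  have hl2 : Filter.Tendsto (fun K => maxOp β N p (f - φ K)) Filter.atTop (nhds 0) :=
    hlim_of_sq fun K => hbd (f - φ K)
  have hl1' : Filter.Tendsto (fun K => (φ K : WeightedHardy β)) Filter.atTop (nhds f.1) := by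
    have := hl1.const_sub f.1
    simpa using this
  have hl2' : Filter.Tendsto (fun K => maxOp β N p (φ K)) Filter.atTop
      (nhds (maxOp β N p f)) := by
    have := hl2.const_sub (maxOp β N p f)
    simpa [LinearPMap.map_sub] using this
  refine mem_closure_of_tendsto (hl1'.prodMk_nhds hl2') (Filter.Eventually.of_forall fun K => ?_)
  exact LinearPMap.mem_graph (minOp β N p)
    ⟨(φ K).1, truncation_mem_polynomials K f.1, (φ K).2⟩

/-! ### Resolvent bounds and compactness -/

section Resolvent

variable {H : Type*} [NormedAddCommGroup H] [NormedSpace ℂ H] {T : H →ₗ.[ℂ] H}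

lemma IsResolventAt.mem_domain {μ : ℂ} {R : H →L[ℂ] H} (h : IsResolventAt T μ R) (g : H) :
    R g ∈ T.domain := by
  obtain ⟨f, hf, -⟩ := h.1 g
  rw [← hf]
  exact f.2

lemma IsResolventAt.apply {μ : ℂ} {R : H →L[ℂ] H} (h : IsResolventAt T μ R) (g : H) :
    T ⟨R g, h.mem_domain g⟩ = g + μ • R g := by
  obtain ⟨f, hf, hg⟩ := h.1 g
  have e : f = ⟨R g, h.mem_domain g⟩ := Subtype.ext hf
  subst e
  exact sub_eq_iff_eq_add.1 hg

/-- From `R g = R₀ (g + (μ - μ₀) • R g)`, the last term is at most half of `‖R g‖` and is absorbed.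
This local bound makes norms uniform on compact sets. -/
lemma IsResolventAt.norm_le_of_near {μ₀ μ : ℂ} {R₀ R : H →L[ℂ] H} (h₀ : IsResolventAt T μ₀ R₀)
    (h : IsResolventAt T μ R) (hμ : ‖μ - μ₀‖ * ‖R₀‖ ≤ 1 / 2) : ‖R‖ ≤ 2 * ‖R₀‖ := by
  refine R.opNorm_le_bound (by positivity) fun g => ?_
  have e := h₀.2 ⟨R g, h.mem_domain g⟩
  rw [h.apply] at e
  have e2 : g + μ • R g - μ₀ • R g = g + (μ - μ₀) • R g := by rw [sub_smul]; abel
  change R₀ (g + μ • R g - μ₀ • R g) = R g at e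
  rw [e2] at e
  have h1 : ‖R g‖ ≤ ‖R₀‖ * (‖g‖ + ‖μ - μ₀‖ * ‖R g‖) := by
    calc ‖R g‖ = ‖R₀ (g + (μ - μ₀) • R g)‖ := by rw [e]
      _ ≤ ‖R₀‖ * ‖g + (μ - μ₀) • R g‖ := R₀.le_opNorm _
      _ ≤ _ := by
        gcongr
        exact (norm_add_le _ _).trans (by rw [norm_smul])
  have h2 : ‖μ - μ₀‖ * ‖R₀‖ * ‖R g‖ ≤ 1 / 2 * ‖R g‖ := by gcongr
  nlinarith

lemma exists_resolvent_bound_on_compact {K : Set ℂ} (hK : IsCompact K)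
    (hKT : K ⊆ resolventSetOf T) :
    ∃ b : ℝ, 0 ≤ b ∧ ∀ μ ∈ K, ∀ R : H →L[ℂ] H, IsResolventAt T μ R → ‖R‖ ≤ b := by
  refine hK.induction_on (p := fun s => ∃ b : ℝ, 0 ≤ b ∧ ∀ μ ∈ s, ∀ R : H →L[ℂ] H,
    IsResolventAt T μ R → ‖R‖ ≤ b) ⟨0, le_rfl, fun μ hμ => hμ.elim⟩ ?_ ?_ fun μ₀ hμ₀ => ?_
  · rintro s t hst ⟨b, hb, h⟩
    exact ⟨b, hb, fun μ hμ => h μ (hst hμ)⟩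
  · rintro s t ⟨b, hb, h⟩ ⟨b', hb', h'⟩
    refine ⟨max b b', hb.trans (le_max_left _ _), fun μ hμ R hR => ?_⟩
    rcases hμ with hμ | hμ
    · exact (h μ hμ R hR).trans (le_max_left _ _)
    · exact (h' μ hμ R hR).trans (le_max_right _ _)
  · obtain ⟨R₀, hR₀⟩ := hKT hμ₀
    refine ⟨{μ | ‖μ - μ₀‖ * ‖R₀‖ < 1 / 2}, mem_nhdsWithin_of_mem_nhds ?_,
      2 * ‖R₀‖, by positivity, fun μ hμ R hR => hR₀.norm_le_of_near hR (le_of_lt hμ)⟩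
    refine IsOpen.mem_nhds (isOpen_lt (by fun_prop) continuous_const) ?_
    simp

end Resolvent

/-- Sobolev estimate for the range of the resolvent. -/
lemma exists_resolvent_sobolev_estimate (hσ : 0 < σ)
    (hβ : ∀ n : ℕ, β (n + 1) ^ 2 = β n ^ 2 * (((n : ℝ) + 1) / ((n : ℝ) + σ)))
    (hreg : DiskRegular N p) (hsymm : FormallySymmetric β N p) :
    ∃ C : ℝ, 0 ≤ C ∧ ∀ (μ : ℂ) (R : WeightedHardy β →L[ℂ] WeightedHardy β) (b M : ℝ),
      IsResolventAt (maxOp β N p) μ R → ‖R‖ ≤ b → ‖μ‖ ≤ M → ∀ g,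
      (Summable fun n : ℕ => (((n : ℝ) + 1) ^ N * ‖coord (R g) n‖) ^ 2) ∧
      ∑' n : ℕ, (((n : ℝ) + 1) ^ N * ‖coord (R g) n‖) ^ 2 ≤
        (C * (1 + M * b + b) * ‖g‖) ^ 2 := by
  obtain ⟨K, hK, H⟩ := maxOp_regularity hσ hβ hreg hsymm
  refine ⟨Real.sqrt K, Real.sqrt_nonneg K, fun μ R b M hR hb hM g => ?_⟩
  obtain ⟨h1, h2⟩ := H ⟨R g, hR.mem_domain g⟩
  refine ⟨h1, h2.trans ?_⟩
  -- The graph norm of `R g` is explicit, because the operator sends `R g` to `g + μ • R g`.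
  rw [hR.apply, mul_pow, mul_pow, Real.sq_sqrt hK, mul_assoc]
  refine mul_le_mul_of_nonneg_left ?_ hK
  have hb0 : 0 ≤ b := (norm_nonneg _).trans hb
  have hM0 : 0 ≤ M := (norm_nonneg _).trans hM
  have e1 : ‖R g‖ ≤ b * ‖g‖ := R.le_of_opNorm_le hb g
  have e2 : ‖g + μ • R g‖ ≤ ‖g‖ + M * (b * ‖g‖) := by
    refine (norm_add_le _ _).trans ?_
    rw [norm_smul]
    gcongr
  change ‖g + μ • R g‖ ^ 2 + ‖R g‖ ^ 2 ≤ _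
  calc _ ≤ (‖g‖ + M * (b * ‖g‖)) ^ 2 + (b * ‖g‖) ^ 2 := by gcongr
    _ ≤ ((‖g‖ + M * (b * ‖g‖)) + b * ‖g‖) ^ 2 := by
        have : 0 ≤ (‖g‖ + M * (b * ‖g‖)) * (b * ‖g‖) := by positivity
        nlinarith
    _ = _ := by ring

lemma sobolev_sq_le (n : ℕ) (f : ℂ⟦X⟧) :
    ‖PowerSeries.coeff n f‖ ^ 2 * (β.sobolev N) n ^ 2 ≤
      2 * (((n : ℝ) + 1) ^ N * ‖PowerSeries.coeff n f * (β n : ℂ)‖) ^ 2 := by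
  have h1 : (β.sobolev N) n ^ 2 = (1 + (n : ℝ) ^ (2 * N)) * β n ^ 2 := by
    change (Real.sqrt (1 + (n : ℝ) ^ (2 * N)) * β n) ^ 2 = _
    rw [mul_pow, Real.sq_sqrt (by positivity)]
  have hn : (0 : ℝ) ≤ n := Nat.cast_nonneg n
  have h2 : (1 : ℝ) ≤ ((n : ℝ) + 1) ^ (2 * N) := one_le_pow₀ (by linarith)
  have h3 : (n : ℝ) ^ (2 * N) ≤ ((n : ℝ) + 1) ^ (2 * N) :=
    pow_le_pow_left₀ hn (by linarith) _
  rw [h1, norm_mul, Complex.norm_real, Real.norm_of_nonneg (β.pos n).le]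
  calc _ ≤ ‖PowerSeries.coeff n f‖ ^ 2 *
        ((((n : ℝ) + 1) ^ (2 * N) + ((n : ℝ) + 1) ^ (2 * N)) * β n ^ 2) := by gcongr
    _ = _ := by ring

/-- The operator `S` is `R` with its codomain restricted. Boundedness at a single point of the
resolvent set is the case of a one-point compact set. -/
lemma exists_resolvent_to_sobolev (hσ : 0 < σ)
    (hβ : ∀ n : ℕ, β (n + 1) ^ 2 = β n ^ 2 * (((n : ℝ) + 1) / ((n : ℝ) + σ)))
    (hreg : DiskRegular N p) (hsymm : FormallySymmetric β N p) {K : Set ℂ} (hK : IsCompact K)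
    (hKT : K ⊆ resolventSetOf (maxOp β N p)) :
    ∃ C : ℝ, ∀ μ ∈ K, ∀ R : WeightedHardy β →L[ℂ] WeightedHardy β,
      IsResolventAt (maxOp β N p) μ R →
      ∃ S : WeightedHardy β →L[ℂ] WeightedHardy (β.sobolev N),
        (∀ g, (S g : ℂ⟦X⟧) = (R g : ℂ⟦X⟧)) ∧ ‖S‖ ≤ C := by
  obtain ⟨b, hb, hbR⟩ := exists_resolvent_bound_on_compact hK hKT
  obtain ⟨M, hM⟩ := hK.isBounded.exists_norm_le
  obtain ⟨C, hC, H⟩ := exists_resolvent_sobolev_estimate hσ hβ hreg hsymm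
  -- The squared norms differ by a factor `2` (`sobolev_sq_le`), and `2` is used in place of its
  -- square root.
  refine ⟨2 * (C * (1 + |M| * b + b)), fun μ hμ R hR => ?_⟩
  have key := fun g => H μ R b |M| hR (hbR μ hμ R hR) ((hM μ hμ).trans (le_abs_self M)) g
  have hmem : ∀ g, (R g : ℂ⟦X⟧) ∈ WeightedHardy (β.sobolev N) := fun g =>
    Summable.of_nonneg_of_le (fun n => by positivity) (fun n => sobolev_sq_le n _)
      ((key g).1.mul_left 2)
  let S : WeightedHardy β →ₗ[ℂ] WeightedHardy (β.sobolev N) :=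
    { toFun := fun g => ⟨(R g : ℂ⟦X⟧), hmem g⟩
      map_add' := fun f g => Subtype.ext
        (congrArg (fun h : WeightedHardy β => (h : ℂ⟦X⟧)) (map_add R f g))
      map_smul' := fun c g => Subtype.ext
        (congrArg (fun h : WeightedHardy β => (h : ℂ⟦X⟧)) (map_smul R c g)) }
  have hSR : ∀ g, (S g : ℂ⟦X⟧) = (R g : ℂ⟦X⟧) := fun g => rfl
  have hS : ∀ g, ‖S g‖ ≤ 2 * (C * (1 + |M| * b + b)) * ‖g‖ := fun g => by
    refine le_of_sq_le_sq ?_ (by positivity)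
    have h1 : ‖S g‖ ^ 2 ≤ 2 * (C * (1 + |M| * b + b) * ‖g‖) ^ 2 := by
      rw [norm_sq_eq, hSR]
      refine le_trans ?_ (mul_le_mul_of_nonneg_left (key g).2 zero_le_two)
      rw [← tsum_mul_left]
      exact Summable.tsum_le_tsum (fun n => sobolev_sq_le n _) (hmem g) ((key g).1.mul_left 2)
    refine h1.trans ?_
    nlinarith [sq_nonneg (C * (1 + |M| * b + b) * ‖g‖)]
  exact ⟨S.mkContinuous _ hS, fun g => hSR g, S.mkContinuous_norm_le (by positivity) hS⟩

/-- Cutting `R g` at degree `K` removes only terms with `n ≥ K`, where the Sobolev bound gains `(n +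
1) ^ N ≥ K + 1` as `N ≥ 1`. So `R` is a norm limit of finite-rank operators. -/
lemma resolvent_isCompactOperator (hσ : 0 < σ)
    (hβ : ∀ n : ℕ, β (n + 1) ^ 2 = β n ^ 2 * (((n : ℝ) + 1) / ((n : ℝ) + σ))) (hN : 1 ≤ N)
    (hreg : DiskRegular N p) (hsymm : FormallySymmetric β N p) {μ : ℂ}
    {R : WeightedHardy β →L[ℂ] WeightedHardy β} (hR : IsResolventAt (maxOp β N p) μ R) :
    IsCompactOperator R := by
  obtain ⟨C, hC, H⟩ := exists_resolvent_sobolev_estimate hσ hβ hreg hsymm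
  have key := fun g => H μ R ‖R‖ ‖μ‖ hR le_rfl le_rfl g
  set B : ℝ := C * (1 + ‖μ‖ * ‖R‖ + ‖R‖) with hB
  have hB0 : 0 ≤ B := by positivity
  have hbound : ∀ K : ℕ, ‖(truncation β K).comp R - R‖ ≤ B * (1 / ((K : ℝ) + 1)) := fun K => by
    refine ContinuousLinearMap.opNorm_le_bound _ (by positivity) fun g => ?_
    refine le_of_sq_le_sq ?_ (by positivity)
    have hx : (0 : ℝ) < (K : ℝ) + 1 := by positivity
    have e : (B * (1 / ((K : ℝ) + 1)) * ‖g‖) ^ 2 = (1 / ((K : ℝ) + 1)) ^ 2 * (B * ‖g‖) ^ 2 := by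
      ring
    rw [e]
    refine le_trans ?_ (mul_le_mul_of_nonneg_left (key g).2 (by positivity))
    rw [norm_sq_eq_coord, ← tsum_mul_left]
    refine (summable_coord _).tsum_le_tsum (fun n => ?_) ((key g).1.mul_left _)
    change ‖coord (truncation β K (R g) - R g) n‖ ^ 2 ≤ _
    rw [coord_sub, coord_truncation]
    split_ifs with hn
    · rw [sub_self, norm_zero, zero_pow two_ne_zero]; positivity
    · rw [zero_sub, norm_neg, ← mul_pow]
      refine pow_le_pow_left₀ (norm_nonneg _) ?_ 2
      have h1 : (K : ℝ) ≤ n := by exact_mod_cast not_lt.1 hn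
      have h2 : (K : ℝ) + 1 ≤ ((n : ℝ) + 1) ^ N :=
        (by linarith : (K : ℝ) + 1 ≤ (n : ℝ) + 1).trans
          (le_self_pow₀ (by linarith [(Nat.cast_nonneg n : (0 : ℝ) ≤ n)]) (by omega))
      rw [← mul_assoc, one_div_mul_eq_div]
      refine le_mul_of_one_le_left (norm_nonneg _) ?_
      rwa [one_le_div₀ hx]
  refine isCompactOperator_of_tendsto (F := fun K => (truncation β K).comp R) (l := Filter.atTop)
    ?_ (Filter.Eventually.of_forall fun K => (isCompactOperator_truncation β K).comp_clm R)
  rw [tendsto_iff_norm_sub_tendsto_zero]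
  refine squeeze_zero (fun _ => norm_nonneg _) hbound ?_
  simpa using tendsto_one_div_add_atTop_nhds_zero_nat.const_mul B

end

theorem theorem3 (σ : ℝ) (hσ : 0 < σ) (β : WeightSeq)
    (hβ0 : β 0 = 1) (hβ1 : β 1 ^ 2 = 1 / σ)
    (hβ : ∀ m : ℕ, 1 ≤ m → β (m + 1) ^ 2 = β m ^ 2 * (((m : ℝ) + 1) / ((m : ℝ) + σ)))
    (N : ℕ) (hN : 1 ≤ N) (p : ℕ → ℂ → ℂ)
    (hreg : DiskRegular N p) (hsymm : FormallySymmetric β N p) :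
    -- all polynomials are in the domain of the minimal operator
    (minOp β N p).domain = WeightedHardy.polynomials β ∧
    -- the maximal operator is the closure of the minimal one, and is self-adjoint
    (minOp β N p).IsClosable ∧ (minOp β N p).closure = maxOp β N p ∧
    Dense ((maxOp β N p).domain : Set (WeightedHardy β)) ∧ IsSelfAdjoint (maxOp β N p) ∧
    -- the resolvent is bounded into the Sobolev-type space, uniformly on compact sets
    (∀ K : Set ℂ, IsCompact K → K ⊆ resolventSetOf (maxOp β N p) →
      ∃ C : ℝ, ∀ μ ∈ K, ∀ R : WeightedHardy β →L[ℂ] WeightedHardy β,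
        IsResolventAt (maxOp β N p) μ R →
        ∃ S : WeightedHardy β →L[ℂ] WeightedHardy (β.sobolev N),
          (∀ g, (S g : ℂ⟦X⟧) = (R g : ℂ⟦X⟧)) ∧ ‖S‖ ≤ C) ∧
    -- the resolvent is a compact operator
    (∀ (μ : ℂ) (R : WeightedHardy β →L[ℂ] WeightedHardy β),
      IsResolventAt (maxOp β N p) μ R → IsCompactOperator R) := by
  -- The values of `β 0` and `β 1` are the case `n = 0` of the same recursion, since `(0 + 1) / (0 +
  -- σ) = 1 / σ`.
  have hβ' : ∀ n : ℕ, β (n + 1) ^ 2 = β n ^ 2 * (((n : ℝ) + 1) / ((n : ℝ) + σ)) := fun n => by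
    rcases n with _ | n
    · simp [hβ1, hβ0]
    · exact hβ (n + 1) (Nat.le_add_left 1 n)
  obtain ⟨hcl, hcl'⟩ := minOp_closure_eq hσ hβ' hreg hsymm
  exact ⟨minOp_domain hσ hβ' hreg, hcl, hcl', maxOp_domain_dense hσ hβ' hreg,
    maxOp_isSelfAdjoint hσ hβ' hreg hsymm,
    fun K hK hKT => exists_resolvent_to_sobolev hσ hβ' hreg hsymm hK hKT,
    fun μ R hR => resolvent_isCompactOperator hσ hβ' hN hreg hsymm hR⟩
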